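/- Let $n\ge 3$. A trisp (triangulated space) is given by sets of $k$-simplices, $k\ge 0$, the vertices of each simplex being linearly ordered, together with compatible maps that assign to a $k$-simplex and an order-preserving injection $\{0,\dots,m\}\to\{0,\dots,k\}$ the corresponding $m$-face. An elementary collapse removes from a (sub)trisp two simplices $\sigma,\tau$ with $\dim\tau=\dim\sigma+1$ such that $\sigma$ is a face of $\tau$ in exactly one way and $\sigma$ is a face of no simplex other than $\sigma$ and $\tau$. A trisp collapses onto a subtrisp if finitely many (possibly zero) elementary collapses lead from it to the subtrisp, and it is collapsible if it collapses onto a single vertex. The nerve $\Delta(P)$ of a poset $P$ is the trisp whose $k$-simplices are the chains $a_0<\dots<a_k$ in $P$, with subchains as faces. If a group $G$ acts on $P$ by order automorphisms, then $\Delta(P)/G$ is the trisp whose simplices are the $G$-orbits of simplices of $\Delta(P)$, with faces induced from those of $\Delta(P)$. Let $DG_n$ be the simplicial complex whose vertices are the 2-element subsets of $\{1,\dots,n\}$ and whose simplices are the edge sets of disconnected graphs on the vertex set $\{1,\dots,n\}$. Let $\overline{\mathcal F(DG_n)}$ be the poset of its nonempty simplices ordered by inclusion, so that $\Delta(\overline{\mathcal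 F(DG_n)})=\mathrm{bd}(DG_n)$ is the barycentric subdivision of $DG_n$. Let $\overline{\Pi_n}$ be the poset of all partitions of $\{1,\dots,n\}$ other than $1|2|\dots|n$ and $12\dots n$, ordered by refinement (finer partitions are smaller). The symmetric group $\mathcal S_n$ acts on both posets by permuting $\{1,\dots,n\}$. Then: 1. The trisp $\mathrm{bd}(DG_n)/\mathcal S_n=\Delta(\overline{\mathcal F(DG_n)})/\mathcal S_n$ is collapsible. 2. The $\mathcal S_n$-equivariant order embedding $\overline{\Pi_n}\to\overline{\mathcal F(DG_n)}$ that takes a partition to the edge set of the disjoint union of the complete graphs on its blocks induces a trisp map $\Delta(\overline{\Pi_n})/\mathcal S_n\to\mathrm{bd}(DG_n)/\mathcal S_n$ that is injective on simplices of each dimension, and $\mathrm{bd}(DG_n)/\mathcal S_n$ collapses onto its image, i.e. onto the subtrisp $\Delta(\overline{\Pi_n})/\mathcal S_n$. 3. The trisp $\Delta(\overline{\Pi_n})/\mathcal S_n$ is collapsible. -/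

import Mathlib

/-! ### Trisps (triangulated spaces) and collapses -/

/-- A *trisp*: a set of `k`-simplices for every `k ≥ 0`, where the vertices of every `k`-simplex
are totally ordered (numbered `0, …, k`), together with, for every order preserving injection
`f : {0, …, m} → {0, …, k}`, the map taking a `k`-simplex to its `m`-face spanned by the vertices
with numbers in the image of `f`. -/
structure Trisp where
  Simplex : ℕ → Type
  face : ∀ {m k : ℕ}, (Fin (m + 1) ↪o Fin (k + 1)) → Simplex k → Simplex m
  face_refl : ∀ {k : ℕ} (σ : Simplex k), face (RelEmbedding.refl _) σ = σ
  face_trans : ∀ {l m k : ℕ} (f : Fin (l + 1) ↪o Fin (m + 1)) (g : Fin (m + 1) ↪o Fin (k + 1))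
    (σ : Simplex k), face (f.trans g) σ = face f (face g σ)

namespace Trisp

/-- A map of trisps: it takes `k`-simplices to `k`-simplices and commutes with taking faces. -/
structure Hom (S T : Trisp) where
  toFun : ∀ {k : ℕ}, S.Simplex k → T.Simplex k
  map_face : ∀ {m k : ℕ} (f : Fin (m + 1) ↪o Fin (k + 1)) (σ : S.Simplex k),
    toFun (S.face f σ) = T.face f (toFun σ)

/-- A subtrisp: a set of simplices (of all dimensions) that is closed under taking faces. -/
structure Subtrisp (T : Trisp) where
  carrier : Set (Σ k : ℕ, T.Simplex k)
  face_mem : ∀ {m k : ℕ} (f : Fin (m + 1) ↪o Fin (k + 1)) (σ : T.Simplex k),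
    (⟨k, σ⟩ : Σ k : ℕ, T.Simplex k) ∈ carrier → (⟨m, T.face f σ⟩ : Σ k : ℕ, T.Simplex k) ∈ carrier

/-- The whole trisp as a subtrisp of itself. -/
def whole (T : Trisp) : T.Subtrisp where
  carrier := Set.univ
  face_mem _ _ _ := Set.mem_univ _

/-- The image of a trisp map. -/
def Hom.range {S T : Trisp} (F : Hom S T) : T.Subtrisp where
  carrier := {x | ∃ σ : S.Simplex x.1, F.toFun σ = x.2}
  face_mem := by
    rintro m k f τ ⟨σ, hσ⟩
    exact ⟨S.face f σ, (F.map_face f σ).trans (congrArg _ hσ)⟩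

/-- `K` collapses to `L` by one elementary collapse: `L` arises from `K` by removing two simplices
`σ`, `τ` with `dim τ = dim σ + 1`, where `σ` is a face of `τ` in exactly one way, and no simplices
of `K` other than `σ` and `τ` have `σ` as a face. -/
def ElementaryCollapse {T : Trisp} (K L : T.Subtrisp) : Prop :=
  ∃ (k : ℕ) (σ : T.Simplex k) (τ : T.Simplex (k + 1)),
    (⟨k + 1, τ⟩ : Σ k : ℕ, T.Simplex k) ∈ K.carrier ∧
    (∃! f : Fin (k + 1) ↪o Fin (k + 1 + 1), T.face f τ = σ) ∧
    (∀ (m : ℕ) (ρ : T.Simplex m), (⟨m, ρ⟩ : Σ k : ℕ, T.Simplex k) ∈ K.carrier →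
      (∃ f : Fin (k + 1) ↪o Fin (m + 1), T.face f ρ = σ) →
        (⟨m, ρ⟩ : Σ k : ℕ, T.Simplex k) = ⟨k, σ⟩ ∨
        (⟨m, ρ⟩ : Σ k : ℕ, T.Simplex k) = ⟨k + 1, τ⟩) ∧
    L.carrier = K.carrier \ {⟨k, σ⟩, ⟨k + 1, τ⟩}

/-- `T` *collapses onto* its subtrisp `L`: finitely many elementary collapses lead from `T`
to `L`. -/
def CollapsesOnto (T : Trisp) (L : T.Subtrisp) : Prop :=
  Relation.ReflTransGen ElementaryCollapse T.whole L

/-- A trisp is *collapsible* if it collapses onto a single vertex. -/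
def Collapsible (T : Trisp) : Prop :=
  ∃ (v : T.Simplex 0) (L : T.Subtrisp), L.carrier = {⟨0, v⟩} ∧ T.CollapsesOnto L

/-! ### Group actions on trisps and quotients -/

/-- An action of the group `G` on a trisp: an action on the simplices of each dimension that
commutes with taking faces (and thus respects the order of the vertices of each simplex). -/
structure Action (G : Type) [Group G] (T : Trisp) where
  act : ∀ k : ℕ, G →* Equiv.Perm (T.Simplex k)
  face_act : ∀ {m k : ℕ} (f : Fin (m + 1) ↪o Fin (k + 1)) (g : G) (σ : T.Simplex k),
    T.face f (act k g σ) = act m g (T.face f σ)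

/-- Two `k`-simplices are equivalent if they lie in the same `G`-orbit. -/
def Action.orbitRel {G : Type} [Group G] {T : Trisp} (A : T.Action G) (k : ℕ) :
    Setoid (T.Simplex k) where
  r σ τ := ∃ g : G, A.act k g σ = τ
  iseqv :=
    { refl := fun σ => ⟨1, by simp⟩
      symm := by
        rintro σ _ ⟨g, rfl⟩
        exact ⟨g⁻¹, by simp⟩
      trans := by
        rintro σ _ _ ⟨g, rfl⟩ ⟨h, rfl⟩
        exact ⟨h * g, by simp⟩ }

/-- The quotient trisp `T / G`: its simplices are the `G`-orbits of simplices of `T`, and the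
faces of the orbit of `σ` are the orbits of the faces of `σ`. -/
def quotient {G : Type} [Group G] (T : Trisp) (A : T.Action G) : Trisp where
  Simplex k := Quotient (A.orbitRel k)
  face f := Quotient.map (T.face f) (by
    rintro σ _ ⟨g, rfl⟩
    exact ⟨g, (A.face_act f g σ).symm⟩)
  face_refl := by
    rintro k ⟨σ⟩
    exact congrArg _ (T.face_refl σ)
  face_trans := by
    rintro l m k f g ⟨σ⟩
    exact congrArg _ (T.face_trans f g σ)

/-- An equivariant trisp map induces a map of the quotients, taking the orbit of `σ` to the orbit
of the image of `σ`. -/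
def Hom.quotientMap {G : Type} [Group G] {S T : Trisp} (F : Hom S T) (A : S.Action G)
    (B : T.Action G)
    (hF : ∀ (k : ℕ) (g : G) (σ : S.Simplex k), F.toFun (A.act k g σ) = B.act k g (F.toFun σ)) :
    Hom (S.quotient A) (T.quotient B) where
  toFun {k} := Quotient.map F.toFun (by
    rintro σ _ ⟨g, rfl⟩
    exact ⟨g, (hF k g σ).symm⟩)
  map_face := by
    rintro m k f ⟨σ⟩
    exact congrArg _ (F.map_face f σ)

/-! ### Nerves of posets -/

/-- The nerve `Δ(P)` of a poset: the `k`-simplices are the chains `a₀ < a₁ < … < aₖ`, and faces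
are subchains. -/
def nerve (P : Type) [PartialOrder P] : Trisp where
  Simplex k := Fin (k + 1) ↪o P
  face f σ := f.trans σ
  face_refl _ := rfl
  face_trans _ _ _ := rfl

/-- The action on `Δ(P)` induced by an action of `G` on `P` by order automorphisms:
`g (a₀ < … < aₖ) = (g a₀ < … < g aₖ)`. -/
def nerveAction {G P : Type} [Group G] [PartialOrder P] (A : G →* (P ≃o P)) :
    (nerve P).Action G where
  act k :=
    { toFun := fun g =>
        { toFun := fun σ => RelEmbedding.trans σ (A g).toOrderEmbedding
          invFun := fun σ => RelEmbedding.trans σ (A g).symm.toOrderEmbedding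
          left_inv := fun σ => by
            refine RelEmbedding.ext fun i => ?_
            exact (A g).symm_apply_apply _
          right_inv := fun σ => by
            refine RelEmbedding.ext fun i => ?_
            exact (A g).apply_symm_apply _ }
      map_one' := by
        refine Equiv.ext fun σ => RelEmbedding.ext fun i => ?_
        change A 1 _ = _
        rw [map_one]
        rfl
      map_mul' := fun g h => by
        refine Equiv.ext fun σ => RelEmbedding.ext fun i => ?_
        change A (g * h) _ = _
        rw [map_mul]
        rfl }
  face_act _ _ _ := rfl

/-- An order embedding `P → Q` induces a trisp map `Δ(P) → Δ(Q)`. -/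
def nerveMap {P Q : Type} [PartialOrder P] [PartialOrder Q] (j : P ↪o Q) :
    Hom (nerve P) (nerve Q) where
  toFun σ := RelEmbedding.trans σ j
  map_face _ _ := rfl

end Trisp

/-! ### The complex of disconnected graphs -/

/-- The complex `DG_n` of disconnected graphs. The possible edges are the 2-element subsets of
`Fin n`, that is, the non-diagonal elements of `Sym2 (Fin n)`. The (nonempty) faces are the
nonempty sets of edges `s` for which the graph on the vertex set `Fin n` with edge set `s` is
disconnected. -/
def DG (n : ℕ) : PreAbstractSimplicialComplex (Sym2 (Fin n)) where
  faces := {s | s.Nonempty ∧ (∀ e ∈ s, ¬ e.IsDiag) ∧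
    ¬ (SimpleGraph.fromEdgeSet (s : Set (Sym2 (Fin n)))).Connected}
  isRelLowerSet_faces := by
    rintro s ⟨h0, h1, h2⟩
    refine ⟨h0, fun t hts ht => ⟨ht, fun e he => h1 e (hts he), fun hc => h2 ?_⟩⟩
    exact hc.mono (SimpleGraph.fromEdgeSet_mono (by exact_mod_cast hts))

/-- The face poset of a simplicial complex: its nonempty faces, ordered by inclusion. -/
abbrev FacePoset {V : Type} (K : PreAbstractSimplicialComplex V) : Type := {s : Finset V // s ∈ K}

/-- The barycentric subdivision of a simplicial complex: the nerve of its face poset. -/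
def bd {V : Type} (K : PreAbstractSimplicialComplex V) : Trisp := Trisp.nerve (FacePoset K)

theorem mem_DG_iff {n : ℕ} {s : Finset (Sym2 (Fin n))} :
    s ∈ DG n ↔ s.Nonempty ∧ (∀ e ∈ s, ¬ e.IsDiag) ∧
      ¬ (SimpleGraph.fromEdgeSet (s : Set (Sym2 (Fin n)))).Connected := Iff.rfl

theorem mem_map_sym2Map {n : ℕ} (g : Equiv.Perm (Fin n)) (s : Finset (Sym2 (Fin n)))
    (x y : Fin n) :
    s(x, y) ∈ s.map (Equiv.toEmbedding g).sym2Map ↔ s(g⁻¹ x, g⁻¹ y) ∈ s := by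
  have : s(x, y) = (Equiv.toEmbedding g).sym2Map s(g⁻¹ x, g⁻¹ y) := by simp
  rw [this, Finset.mem_map']

theorem map_mem_DG {n : ℕ} (g : Equiv.Perm (Fin n)) {s : Finset (Sym2 (Fin n))} (hs : s ∈ DG n) :
    s.map (Equiv.toEmbedding g).sym2Map ∈ DG n := by
  rw [mem_DG_iff] at hs ⊢
  obtain ⟨h0, h1, h2⟩ := hs
  refine ⟨h0.map, ?_, fun hc => h2 ?_⟩
  · intro e he
    obtain ⟨e, he, rfl⟩ := Finset.mem_map.1 he
    induction e with
    | _ x y =>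
      have := h1 _ ((Finset.mem_map' _).1 he)
      simpa using this
  · let F : SimpleGraph.fromEdgeSet (s : Set (Sym2 (Fin n))) ≃g
        SimpleGraph.fromEdgeSet
          ((s.map (Equiv.toEmbedding g).sym2Map : Finset _) : Set (Sym2 (Fin n))) :=
      { toEquiv := g
        map_rel_iff' := by
          intro a b
          simp only [SimpleGraph.fromEdgeSet_adj, Finset.mem_coe]
          have : s(g a, g b) = (Equiv.toEmbedding g).sym2Map s(a, b) := rfl
          rw [this, Finset.mem_map']
          simp }
    exact F.connected_iff.2 hc

/-- The action of `S_n` on the face poset of `DG_n`, induced by the action on the graph vertices: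
`g` takes the edge set `s` to `{ {g x, g y} | {x, y} ∈ s }`. -/
def graphAction (n : ℕ) : Equiv.Perm (Fin n) →* (FacePoset (DG n) ≃o FacePoset (DG n)) where
  toFun g :=
    { toFun := fun s => ⟨s.1.map (Equiv.toEmbedding g).sym2Map, map_mem_DG g s.2⟩
      invFun := fun s => ⟨s.1.map (Equiv.toEmbedding g⁻¹).sym2Map, map_mem_DG g⁻¹ s.2⟩
      left_inv := fun s => by
        refine Subtype.ext ?_
        ext e
        induction e with
        | _ x y =>
          change s(x, y) ∈ (s.1.map _).map _ ↔ s(x, y) ∈ s.1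
          simp only [mem_map_sym2Map]
          simp
      right_inv := fun s => by
        refine Subtype.ext ?_
        ext e
        induction e with
        | _ x y =>
          change s(x, y) ∈ (s.1.map _).map _ ↔ s(x, y) ∈ s.1
          simp only [mem_map_sym2Map]
          simp
      map_rel_iff' := by
        intro s t
        exact Finset.map_subset_map }
  map_one' := by
    refine RelIso.ext fun s => Subtype.ext ?_
    ext e
    induction e with
    | _ x y =>
      change s(x, y) ∈ s.1.map _ ↔ s(x, y) ∈ s.1
      simp only [mem_map_sym2Map]
      simp
  map_mul' g h := by
    refine RelIso.ext fun s => Subtype.ext ?_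
    ext e
    induction e with
    | _ x y =>
      change s(x, y) ∈ s.1.map _ ↔ s(x, y) ∈ (s.1.map _).map _
      simp only [mem_map_sym2Map]
      simp

/-- The trisp `bd(DG_n) / S_n`. -/
def bdDGQuotient (n : ℕ) : Trisp :=
  (bd (DG n)).quotient (Trisp.nerveAction (graphAction n))

/-! ### The partition lattice -/

/-- The poset of all partitions of `Fin n` except the finest one (all blocks are singletons, `⊥`)
and the coarsest one (only one block, `⊤`). A partition is given by the equivalence relation of
being in the same block; the order is refinement, with finer partitions below. -/
abbrev ProperPartition (n : ℕ) : Type := {r : Setoid (Fin n) // r ≠ ⊥ ∧ r ≠ ⊤}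

theorem comap_proper {n : ℕ} (g : Equiv.Perm (Fin n)) {r : Setoid (Fin n)}
    (hr : r ≠ ⊥ ∧ r ≠ ⊤) : r.comap g ≠ ⊥ ∧ r.comap g ≠ ⊤ := by
  refine ⟨fun h => hr.1 ?_, fun h => hr.2 ?_⟩
  · ext x y
    have := Setoid.ext_iff.1 h (g.symm x) (g.symm y)
    simpa [Setoid.comap_rel, Setoid.bot_def] using this
  · ext x y
    have := Setoid.ext_iff.1 h (g.symm x) (g.symm y)
    simpa [Setoid.comap_rel, Setoid.top_def] using this

/-- The action of `S_n` on partitions: `x` and `y` are in the same block of `g π` if and only if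
`g⁻¹ x` and `g⁻¹ y` are in the same block of `π`. -/
def partitionAction (n : ℕ) : Equiv.Perm (Fin n) →* (ProperPartition n ≃o ProperPartition n) where
  toFun g :=
    { toFun := fun r => ⟨r.1.comap (g⁻¹ : Equiv.Perm (Fin n)), comap_proper g⁻¹ r.2⟩
      invFun := fun r => ⟨r.1.comap g, comap_proper g r.2⟩
      left_inv := fun r => by
        refine Subtype.ext (Setoid.ext fun x y => ?_)
        simp [Setoid.comap_rel]
      right_inv := fun r => by
        refine Subtype.ext (Setoid.ext fun x y => ?_)
        simp [Setoid.comap_rel]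
      map_rel_iff' := by
        intro r s
        refine ⟨fun h x y hxy => ?_, fun h x y hxy => h hxy⟩
        have : r.1 (g⁻¹ (g x)) (g⁻¹ (g y)) := by simpa using hxy
        simpa [Setoid.comap_rel] using
          (show s.1.comap (g⁻¹ : Equiv.Perm (Fin n)) (g x) (g y) from h this) }
  map_one' := rfl
  map_mul' g h := by
    refine RelIso.ext fun r => Subtype.ext (Setoid.ext fun x y => ?_)
    change r.1 ((g * h)⁻¹ x) ((g * h)⁻¹ y) ↔ r.1 (h⁻¹ (g⁻¹ x)) (h⁻¹ (g⁻¹ y))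
    simp

/-- The trisp `Δ(Π̄_n) / S_n`. -/
def partitionQuotient (n : ℕ) : Trisp :=
  (Trisp.nerve (ProperPartition n)).quotient (Trisp.nerveAction (partitionAction n))

/-! ### Partitions as transitively closed graphs -/

/-- The edge set of the transitively closed graph belonging to a partition, that is, of the disjoint
union of the complete graphs on the blocks. -/
noncomputable def blockEdges {n : ℕ} (r : Setoid (Fin n)) : Finset (Sym2 (Fin n)) :=
  Set.Finite.toFinset (s := {e | ∃ x y, x ≠ y ∧ r x y ∧ e = s(x, y)}) (Set.toFinite _)

theorem mem_blockEdges {n : ℕ} {r : Setoid (Fin n)} {x y : Fin n} :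
    s(x, y) ∈ blockEdges r ↔ x ≠ y ∧ r x y := by
  simp only [blockEdges, Set.Finite.mem_toFinset, Set.mem_ofPred_eq, Sym2.eq_iff]
  constructor
  · rintro ⟨a, b, hab, hr, ⟨rfl, rfl⟩ | ⟨rfl, rfl⟩⟩
    · exact ⟨hab, hr⟩
    · exact ⟨hab.symm, r.symm hr⟩
  · rintro ⟨h, hr⟩
    exact ⟨x, y, h, hr, Or.inl ⟨rfl, rfl⟩⟩

theorem blockEdges_mem_DG {n : ℕ} {r : Setoid (Fin n)} (hr : r ≠ ⊥ ∧ r ≠ ⊤) :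
    blockEdges r ∈ DG n := by
  rw [mem_DG_iff]
  refine ⟨?_, ?_, fun hc => hr.2 ?_⟩
  · by_contra h
    rw [Finset.not_nonempty_iff_eq_empty] at h
    refine hr.1 (Setoid.ext fun x y => ⟨fun hxy => ?_, ?_⟩)
    · by_contra hne
      have : s(x, y) ∈ blockEdges r := mem_blockEdges.2 ⟨hne, hxy⟩
      simp [h] at this
    · rintro rfl
      exact r.refl x
  · intro e he
    induction e with
    | _ x y => simpa using (mem_blockEdges.1 he).1
  · refine Setoid.ext fun x y => ⟨fun _ => trivial, fun _ => ?_⟩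
    obtain ⟨w⟩ := hc.preconnected x y
    induction w with
    | nil => exact r.refl' _
    | cons h _ ih =>
      rw [SimpleGraph.fromEdgeSet_adj, Finset.mem_coe, mem_blockEdges] at h
      exact r.trans' h.1.2 (ih trivial)

/-- The embedding of the partition poset into the face poset of `DG_n` that takes a partition to
the disjoint union of the complete graphs on its blocks. Its image consists of the transitively
closed graphs. -/
noncomputable def partitionEmbedding (n : ℕ) : ProperPartition n ↪o FacePoset (DG n) :=
  OrderEmbedding.ofMapLEIff (fun r => ⟨blockEdges r.1, blockEdges_mem_DG r.2⟩) (by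
    intro r s
    constructor
    · intro h x y hxy
      by_cases hne : x = y
      · subst hne
        exact s.1.refl x
      · exact (mem_blockEdges.1 (h (mem_blockEdges.2 ⟨hne, hxy⟩))).2
    · intro h e he
      induction e with
      | _ x y =>
        have := mem_blockEdges.1 he
        exact mem_blockEdges.2 ⟨this.1, h this.2⟩)

theorem partitionEmbedding_equivariant {n : ℕ} (g : Equiv.Perm (Fin n)) (r : ProperPartition n) :
    partitionEmbedding n (partitionAction n g r) = graphAction n g (partitionEmbedding n r) := by
  refine Subtype.ext ?_
  ext e
  induction e with
  | _ x y =>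
    change s(x, y) ∈ blockEdges (r.1.comap (g⁻¹ : Equiv.Perm (Fin n))) ↔
      s(x, y) ∈ (blockEdges r.1).map (Equiv.toEmbedding g).sym2Map
    rw [mem_map_sym2Map, mem_blockEdges, mem_blockEdges, Setoid.comap_rel]
    simp

/-- The trisp map `Δ(Π̄_n) / S_n → bd(DG_n) / S_n` taking the orbit of a chain of partitions to the
orbit of the corresponding chain of transitively closed graphs. -/
noncomputable def partitionQuotientMap (n : ℕ) :
    Trisp.Hom (partitionQuotient n) (bdDGQuotient n) :=
  (Trisp.nerveMap (partitionEmbedding n)).quotientMap (Trisp.nerveAction (partitionAction n))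
    (Trisp.nerveAction (graphAction n)) (fun _ g σ =>
      RelEmbedding.ext fun i => partitionEmbedding_equivariant g ((show Fin _ ↪o ProperPartition n from σ) i))

/-! Every collapse here comes from a matching on orbits of chains. A finite trisp collapses onto a
subtrisp once the remaining cells are paired as face and coface, the face occurring exactly once,
and every other coface of a lower cell lies in a pair whose lower cell has larger height
(`collapsesOnto_of_matching`). On the quotient of a nerve the pairing is given by a `Toggle`: an
equivariant rule for adding an element to a chain or removing it, which stays valid on subchains of
the same height. The added element only has to be unique up to the stabilizer of the chain.

For graphs, transitive closure is an equivariant closure operator. Toggling the closure of the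
largest non-closed graph of a chain collapses onto the chains of partitions.

For partitions, call a partition full if it has no singleton blocks. In a chain let `z` be the least
full element, `w` the least full element with a block of more than two points, and `v` the least
element with more than two nontrivial points in some block of `w`. Missing elements are replaced by
`⊤`, so that `v ≤ z ≤ w`. If some element has two inequivalent nontrivial points in one block of
`z`, the largest such element is closed up inside `z` and its closure is toggled. Otherwise the
toggled element is some `t ≤ v` with one pair as nontrivial block in each block of `w` where `v` is
nontrivial, coarser than all chain elements that are thin for `w`. The choices of `t` are conjugate
under the stabilizer of the chain (`IsSelection.exists_stabilizer`): if `z = w`, points inside a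
block of `v` can be swapped; if `z` consists of pairs, whole pairs can be exchanged.

Only single atoms stay unmatched, since their partner would be the empty chain. They form one orbit,
that is, one vertex. Collapsibility of the graph quotient follows by composing the two collapses. -/

namespace Trisp

/-! ### Collapses from acyclic matchings. -/

/-- The set of all simplices of a trisp. -/
abbrev Cell (T : Trisp) : Type := Σ k : ℕ, T.Simplex k

/-- The cell `x` is a face of the cell `y`. -/
def IsFace {T : Trisp} (x y : T.Cell) : Prop :=
  ∃ f : Fin (x.1 + 1) ↪o Fin (y.1 + 1), T.face f y.2 = x.2

theorem IsFace.trans {T : Trisp} {x y z : T.Cell} (h : IsFace x y) (h' : IsFace y z) :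
    IsFace x z := by
  obtain ⟨f, hf⟩ := h
  obtain ⟨g, hg⟩ := h'
  exact ⟨f.trans g, by rw [T.face_trans, hg, hf]⟩

theorem Subtrisp.ext_carrier {T : Trisp} {K L : T.Subtrisp} (h : K.carrier = L.carrier) :
    K = L := by
  cases K
  cases L
  cases h
  rfl

theorem Subtrisp.mem_of_isFace {T : Trisp} (K : T.Subtrisp) {x y : T.Cell} (h : IsFace x y)
    (hy : y ∈ K.carrier) : x ∈ K.carrier := by
  obtain ⟨k, σ⟩ := x
  obtain ⟨m, τ⟩ := y
  obtain ⟨f, hf⟩ := h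
  have := K.face_mem f τ hy
  dsimp only at hf
  rwa [hf] at this

/-- A finite trisp collapses onto a subtrisp if the remaining cells can be matched such that all
further cofaces of a removed face belong to pairs of strictly larger height. -/
theorem collapsesOnto_of_matching {T : Trisp} [Finite T.Cell] (L : T.Subtrisp) {α : Type*}
    [PartialOrder α] (h : T.Cell → α) (M : T.Cell → T.Cell → Prop)
    (dim : ∀ {x y}, M x y → ∃ (k : ℕ) (σ : T.Simplex k) (τ : T.Simplex (k + 1)),
      x = ⟨k, σ⟩ ∧ y = ⟨k + 1, τ⟩ ∧ ∃! f : Fin (k + 1) ↪o Fin (k + 1 + 1), T.face f τ = σ)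
    (right_unique : ∀ {x y y'}, M x y → M x y' → y = y')
    (left_unique : ∀ {x x' y}, M x y → M x' y → x = x')
    (disjoint : ∀ {x y z}, M x y → ¬ M z x)
    (notMem : ∀ {x y}, M x y → x ∉ L.carrier)
    (total : ∀ x, x ∉ L.carrier → (∃ y, M x y) ∨ ∃ y, M y x)
    (order : ∀ {x y}, M x y → ∀ z, IsFace x z →
      z = x ∨ z = y ∨ (∃ y', M z y' ∧ h x < h z) ∨ ∃ x', M x' z ∧ h x < h x') :
    T.CollapsesOnto L := by
  -- Generalized to every intermediate `K` that contains both or neither cell of each pair, by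
  -- induction on the number of cells left to remove.
  suffices H : ∀ (m : ℕ) (K : T.Subtrisp), L.carrier ⊆ K.carrier →
      (∀ x y, M x y → (x ∈ K.carrier ↔ y ∈ K.carrier)) → (K.carrier \ L.carrier).ncard = m →
      Relation.ReflTransGen ElementaryCollapse K L from
    H _ T.whole (Set.subset_univ _) (fun _ _ _ => by simp [whole]) rfl
  intro m
  induction m using Nat.strong_induction_on with
  | _ m ih =>
  intro K hLK hK hm
  by_cases hE : K.carrier ⊆ L.carrier
  · rw [Subtrisp.ext_carrier (hE.antisymm hLK)]
  obtain ⟨a, haK, haL⟩ := Set.not_subset.1 hE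
  have hne : {x | x ∈ K.carrier ∧ ∃ y, M x y}.Nonempty := by
    rcases total a haL with h1 | ⟨y, hy⟩
    · exact ⟨a, haK, h1⟩
    · exact ⟨y, (hK _ _ hy).2 haK, a, hy⟩
  -- A pair whose lower cell has maximal height can be removed: by `order`, any further coface still
  -- in `K` would lie in a higher pair.
  obtain ⟨x, ⟨hxK, y, hxy⟩, hmax⟩ := (Set.toFinite _).exists_maximalFor h _ hne
  have hyK := (hK _ _ hxy).1 hxK
  have hxL := notMem hxy
  have hcof : ∀ z ∈ K.carrier, IsFace x z → z = x ∨ z = y := by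
    intro z hz hf
    rcases order hxy z hf with h1 | h1 | ⟨y', h1, h2⟩ | ⟨x', h1, h2⟩
    · exact Or.inl h1
    · exact Or.inr h1
    · exact absurd (hmax (j := z) ⟨hz, y', h1⟩ h2.le) h2.not_ge
    · exact absurd (hmax (j := x') ⟨(hK _ _ h1).2 hz, z, h1⟩ h2.le) h2.not_ge
  have hfxy : IsFace x y := by
    obtain ⟨k, σ, τ, rfl, rfl, f, hf, -⟩ := dim hxy
    exact ⟨f, hf⟩
  let K' : T.Subtrisp :=
    { carrier := K.carrier \ {x, y}
      face_mem := by
        intro m k f ρ hρ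
        refine ⟨K.face_mem f ρ hρ.1, fun hmem => hρ.2 ?_⟩
        have hface : IsFace (⟨m, T.face f ρ⟩ : T.Cell) ⟨k, ρ⟩ := ⟨f, rfl⟩
        refine hcof _ hρ.1 ?_
        rcases hmem with h1 | h1
        · rwa [h1] at hface
        · rw [Set.mem_singleton_iff] at h1
          rw [h1] at hface
          exact hfxy.trans hface }
  have hstep : ElementaryCollapse K K' := by
    obtain ⟨k, σ, τ, rfl, rfl, hu⟩ := dim hxy
    exact ⟨k, σ, τ, hyK, hu, fun m ρ hρ hf => hcof _ hρ hf, rfl⟩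
  have hyL : y ∉ L.carrier := fun hy => hxL (L.mem_of_isFace hfxy hy)
  refine Relation.ReflTransGen.head hstep (ih _ ?_ K' ?_ ?_ rfl)
  · rw [← hm]
    refine Set.ncard_lt_ncard ?_ (Set.toFinite _)
    refine ⟨fun z hz => ⟨hz.1.1, hz.2⟩, fun hs => ?_⟩
    exact (hs ⟨hxK, hxL⟩).1.2 (Or.inl rfl)
  · intro z hz
    refine ⟨hLK hz, ?_⟩
    rintro (rfl | rfl)
    · exact hxL hz
    · exact hyL hz
  · intro u v huv
    have h1 := hK u v huv
    have h2 : u ∈ ({x, y} : Set T.Cell) ↔ v ∈ ({x, y} : Set T.Cell) := by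
      constructor
      · rintro (rfl | rfl)
        · exact Or.inr (right_unique huv hxy)
        · exact absurd hxy (disjoint huv)
      · rintro (rfl | rfl)
        · exact absurd huv (disjoint hxy)
        · exact Or.inl (left_unique huv hxy)
    change (u ∈ K.carrier ∧ _) ↔ (v ∈ K.carrier ∧ _)
    rw [h1, h2]

/-! ### Collapses along injective maps -/

/-- The image of a subtrisp. -/
def Hom.mapSubtrisp {S T : Trisp} (F : Hom S T) (K : S.Subtrisp) : T.Subtrisp where
  carrier := (fun x : S.Cell => (⟨x.1, F.toFun x.2⟩ : T.Cell)) '' K.carrier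
  face_mem := by
    rintro m k f τ ⟨⟨_, σ⟩, hK, hσ⟩
    cases hσ
    exact ⟨⟨m, S.face f σ⟩, K.face_mem f σ hK, congrArg (Sigma.mk m) (F.map_face f σ)⟩

theorem Hom.mapSubtrisp_whole {S T : Trisp} (F : Hom S T) : F.mapSubtrisp S.whole = F.range := by
  refine Subtrisp.ext_carrier (Set.ext fun x => ⟨?_, ?_⟩)
  · rintro ⟨⟨k, σ⟩, -, rfl⟩
    exact ⟨σ, rfl⟩
  · rintro ⟨σ, hσ⟩
    exact ⟨⟨x.1, σ⟩, Set.mem_univ _, congrArg (Sigma.mk x.1) hσ⟩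

/-- Freeness of a face is tested only on the simplices still present. These all lie in the image,
where injectivity identifies face relations with those of `S`. -/
theorem ElementaryCollapse.map {S T : Trisp} (F : Hom S T)
    (hF : ∀ k : ℕ, Function.Injective (F.toFun : S.Simplex k → T.Simplex k)) {K L : S.Subtrisp}
    (h : ElementaryCollapse K L) : ElementaryCollapse (F.mapSubtrisp K) (F.mapSubtrisp L) := by
  obtain ⟨k, σ, τ, hτ, ⟨f, hf, hfu⟩, hc, hL⟩ := h
  have hF' : ∀ {m k : ℕ} (f : Fin (m + 1) ↪o Fin (k + 1)) (σ : S.Simplex m) (τ : S.Simplex k),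
      T.face f (F.toFun τ) = F.toFun σ ↔ S.face f τ = σ := fun f σ τ => by
    rw [← F.map_face, (hF _).eq_iff]
  have key : ∀ {m k : ℕ} (ρ : S.Simplex m) (σ : S.Simplex k),
      (⟨m, F.toFun ρ⟩ : T.Cell) = ⟨k, F.toFun σ⟩ ↔ (⟨m, ρ⟩ : S.Cell) = ⟨k, σ⟩ := by
    intro m k ρ σ
    constructor
    · intro h
      have h1 : m = k := congrArg Sigma.fst h
      subst h1
      have := hF _ (eq_of_heq (Sigma.mk.inj h).2)
      rw [this]
    · intro h
      have h1 : m = k := congrArg Sigma.fst h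
      subst h1
      rw [eq_of_heq (Sigma.mk.inj h).2]
  refine ⟨k, F.toFun σ, F.toFun τ, ⟨⟨k + 1, τ⟩, hτ, rfl⟩, ⟨f, (hF' _ _ _).2 hf, fun g hg =>
    hfu g ((hF' _ _ _).1 hg)⟩, ?_, ?_⟩
  · rintro _ _ ⟨⟨m, ρ⟩, hρ, h⟩ ⟨g, hg⟩
    cases h
    rcases hc m ρ hρ ⟨g, (hF' _ _ _).1 hg⟩ with h1 | h1
    · exact Or.inl ((key _ _).2 h1)
    · exact Or.inr ((key _ _).2 h1)
  · ext x
    constructor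
    · rintro ⟨⟨m, ρ⟩, hρ, rfl⟩
      rw [hL] at hρ
      refine ⟨⟨_, hρ.1, rfl⟩, fun h => hρ.2 ?_⟩
      rcases h with h | h
      · exact Or.inl ((key _ _).1 h)
      · exact Or.inr ((key _ _).1 h)
    · rintro ⟨⟨⟨m, ρ⟩, hρ, rfl⟩, h⟩
      refine ⟨⟨m, ρ⟩, ?_, rfl⟩
      rw [hL]
      refine ⟨hρ, fun h' => h ?_⟩
      rcases h' with h' | h'
      · exact Or.inl ((key _ _).2 h')
      · exact Or.inr ((key _ _).2 h')

theorem Collapsible.of_injective {S T : Trisp} (F : Hom S T)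
    (hF : ∀ k : ℕ, Function.Injective (F.toFun : S.Simplex k → T.Simplex k))
    (hT : T.CollapsesOnto F.range) (hS : S.Collapsible) : T.Collapsible := by
  obtain ⟨v, L, hL, h⟩ := hS
  refine ⟨F.toFun v, F.mapSubtrisp L, ?_, hT.trans ?_⟩
  · simp [Hom.mapSubtrisp, hL]
  · rw [← F.mapSubtrisp_whole]
    exact Relation.ReflTransGen.lift F.mapSubtrisp (fun _ _ => ElementaryCollapse.map F hF) _ _ h

/-! ### Chains as finite sets -/

section Chains

variable {P : Type} [PartialOrder P]

/-- A simplex of the nerve as an order embedding. -/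
def chainEmb {k : ℕ} (σ : (nerve P).Simplex k) : Fin (k + 1) ↪o P := σ

/-- The set of elements of a chain. -/
def chainSet {k : ℕ} (σ : (nerve P).Simplex k) : Finset P :=
  Finset.univ.map (chainEmb σ).toEmbedding

theorem mem_chainSet {k : ℕ} (σ : (nerve P).Simplex k) {p : P} :
    p ∈ chainSet σ ↔ ∃ i, chainEmb σ i = p := by
  simp [chainSet]

theorem card_chainSet {k : ℕ} (σ : (nerve P).Simplex k) : (chainSet σ).card = k + 1 := by
  simp [chainSet]

theorem chainSet_nonempty {k : ℕ} (σ : (nerve P).Simplex k) : (chainSet σ).Nonempty := by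
  rw [← Finset.card_pos, card_chainSet]
  omega

theorem isChain_chainSet {k : ℕ} (σ : (nerve P).Simplex k) :
    IsChain (· ≤ ·) (chainSet σ : Set P) := by
  intro a ha b hb _
  obtain ⟨i, rfl⟩ := (mem_chainSet σ).1 ha
  obtain ⟨j, rfl⟩ := (mem_chainSet σ).1 hb
  rcases le_total i j with h | h
  · exact Or.inl ((OrderEmbedding.le_iff_le (chainEmb σ)).2 h)
  · exact Or.inr ((OrderEmbedding.le_iff_le (chainEmb σ)).2 h)

theorem chainSet_injective {k : ℕ} :
    Function.Injective (chainSet : (nerve P).Simplex k → Finset P) := by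
  intro σ τ h
  refine OrderEmbedding.range_inj.1 (Set.ext fun p => ?_)
  have := Finset.ext_iff.1 h p
  rw [mem_chainSet, mem_chainSet] at this
  exact this

theorem cell_eq_of_chainSet_eq {k m : ℕ} {σ : (nerve P).Simplex k} {τ : (nerve P).Simplex m}
    (h : chainSet σ = chainSet τ) : (⟨k, σ⟩ : (nerve P).Cell) = ⟨m, τ⟩ := by
  have hk : k = m := by
    have := congrArg Finset.card h
    rw [card_chainSet, card_chainSet] at this
    omega
  subst hk
  rw [chainSet_injective h]

theorem exists_chainSet_eq {c : Finset P} (hc : IsChain (· ≤ ·) (c : Set P)) {k : ℕ}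
    (hk : c.card = k + 1) : ∃ σ : (nerve P).Simplex k, chainSet σ = c := by
  classical
  let l : LinearOrder {p // p ∈ c} :=
    { (inferInstance : PartialOrder {p // p ∈ c}) with
      le_total := fun a b => hc.total a.2 b.2
      toDecidableLE := Classical.decRel _ }
  let e := @monoEquivOfFin {p // p ∈ c} _ l (k + 1) (by simpa using hk)
  let σ : Fin (k + 1) ↪o P :=
    OrderEmbedding.ofMapLEIff (fun i => (e i).1) (fun i j => e.le_iff_le)
  refine ⟨σ, Finset.ext fun p => ?_⟩
  rw [mem_chainSet σ]
  constructor
  · rintro ⟨i, rfl⟩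
    exact (e i).2
  · intro hp
    exact ⟨e.symm ⟨p, hp⟩, by
      change (e (e.symm ⟨p, hp⟩)).1 = p
      rw [OrderIso.apply_symm_apply]⟩

theorem exists_face_eq_iff {m k : ℕ} {σ : (nerve P).Simplex m} {ρ : (nerve P).Simplex k} :
    (∃ f : Fin (m + 1) ↪o Fin (k + 1), (nerve P).face f ρ = σ) ↔ chainSet σ ⊆ chainSet ρ := by
  constructor
  · rintro ⟨f, rfl⟩ p hp
    obtain ⟨i, rfl⟩ := (mem_chainSet _).1 hp
    exact (mem_chainSet _).2 ⟨f i, rfl⟩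
  · intro h
    have h1 : ∀ i, ∃ j, chainEmb ρ j = chainEmb σ i := fun i =>
      (mem_chainSet ρ).1 (h ((mem_chainSet σ).2 ⟨i, rfl⟩))
    choose f hf using h1
    refine ⟨OrderEmbedding.ofMapLEIff f fun i j => ?_, RelEmbedding.ext hf⟩
    rw [← OrderEmbedding.le_iff_le (chainEmb ρ), hf, hf, OrderEmbedding.le_iff_le]

instance [Finite P] : Finite (nerve P).Cell := by
  refine Finite.of_injective (fun x : (nerve P).Cell => chainSet x.2) ?_
  rintro ⟨k, σ⟩ ⟨m, τ⟩ h
  exact cell_eq_of_chainSet_eq h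

variable {G : Type} [Group G] (A : G →* (P ≃o P))

/-- The action of a group element on finite subsets of `P`. -/
def translate (g : G) (c : Finset P) : Finset P := c.map (A g).toEquiv.toEmbedding

variable {A}

theorem mem_translate {g : G} {c : Finset P} {p : P} : A g p ∈ translate A g c ↔ p ∈ c :=
  Finset.mem_map' (A g).toEquiv.toEmbedding

theorem forall_mem_translate {g : G} {c : Finset P} {q : P → Prop} :
    (∀ p ∈ translate A g c, q p) ↔ ∀ p ∈ c, q (A g p) := by
  simp only [translate, Finset.forall_mem_map]
  rfl

theorem exists_mem_translate {g : G} {c : Finset P} {q : P → Prop} :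
    (∃ p ∈ translate A g c, q p) ↔ ∃ p ∈ c, q (A g p) := by
  simp only [translate, Finset.mem_map, exists_exists_and_eq_and]
  rfl

theorem chainSet_act {k : ℕ} (g : G) (σ : (nerve P).Simplex k) :
    chainSet ((nerveAction A).act k g σ) = translate A g (chainSet σ) := by
  rw [translate, chainSet, chainSet, Finset.map_map]
  rfl

variable (A)

/-- The cell of the quotient of the nerve that is given by a chain. -/
def orbitCell {k : ℕ} (σ : (nerve P).Simplex k) : ((nerve P).quotient (nerveAction A)).Cell :=
  ⟨k, Quotient.mk ((nerveAction A).orbitRel k) σ⟩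

variable {A}

theorem exists_orbitCell_eq (x : ((nerve P).quotient (nerveAction A)).Cell) :
    ∃ (k : ℕ) (σ : (nerve P).Simplex k), orbitCell A σ = x := by
  obtain ⟨k, ⟨σ⟩⟩ := x
  exact ⟨k, σ, rfl⟩

instance [Finite P] : Finite ((nerve P).quotient (nerveAction A)).Cell :=
  Finite.of_surjective (fun x : (nerve P).Cell => orbitCell A x.2) fun x => by
    obtain ⟨k, σ, h⟩ := exists_orbitCell_eq x
    exact ⟨⟨k, σ⟩, h⟩

theorem orbitCell_eq_iff {k m : ℕ} {σ : (nerve P).Simplex k} {τ : (nerve P).Simplex m} :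
    orbitCell A σ = orbitCell A τ ↔ ∃ g : G, translate A g (chainSet σ) = chainSet τ := by
  constructor
  · intro h
    obtain ⟨rfl, h2⟩ := Sigma.mk.inj h
    obtain ⟨g, hg⟩ := Quotient.exact (eq_of_heq h2)
    exact ⟨g, by rw [← chainSet_act, hg]⟩
  · rintro ⟨g, hg⟩
    rw [← chainSet_act] at hg
    obtain ⟨rfl, h2⟩ := Sigma.mk.inj (cell_eq_of_chainSet_eq hg)
    refine congrArg (Sigma.mk _) (Quotient.sound ⟨g, eq_of_heq h2⟩)

/-- A coface is an orbit, so its representative can be moved by the group until it contains the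
given chain itself. -/
theorem isFace_orbitCell {m : ℕ} {σ : (nerve P).Simplex m}
    {x : ((nerve P).quotient (nerveAction A)).Cell} (h : IsFace (orbitCell A σ) x) :
    ∃ (k : ℕ) (ρ : (nerve P).Simplex k), orbitCell A ρ = x ∧ chainSet σ ⊆ chainSet ρ := by
  obtain ⟨k, ⟨ρ⟩⟩ := x
  obtain ⟨f, hf⟩ := h
  obtain ⟨g, hg⟩ := Quotient.exact hf
  refine ⟨k, (nerveAction A).act k g ρ, orbitCell_eq_iff.2 ⟨g⁻¹, ?_⟩, exists_face_eq_iff.1 ⟨f, ?_⟩⟩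
  · rw [← chainSet_act]
    simp
  · exact ((nerveAction A).face_act f g ρ).trans hg

/-- If the order automorphisms preserve a rank function, then different faces of a cell of the
quotient of the nerve are different. -/
theorem face_quotient_injective {r : P → ℕ} (hr : StrictMono r) (hrA : ∀ g p, r (A g p) = r p)
    {m k : ℕ} (x : ((nerve P).quotient (nerveAction A)).Simplex k)
    {f f' : Fin (m + 1) ↪o Fin (k + 1)}
    (h : ((nerve P).quotient (nerveAction A)).face f x =
      ((nerve P).quotient (nerveAction A)).face f' x) : f = f' := by
  obtain ⟨ρ⟩ := x
  obtain ⟨g, hg⟩ := Quotient.exact h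
  refine RelEmbedding.ext fun i => ?_
  -- Elements in one orbit have equal rank, and ranks strictly increase along `ρ`, so the two
  -- positions agree.
  have h1 : A g (chainEmb ρ (f i)) = chainEmb ρ (f' i) :=
    DFunLike.congr_fun (F := Fin (m + 1) ↪o P) hg i
  have h2 : r (chainEmb ρ (f i)) = r (chainEmb ρ (f' i)) := by
    rw [← h1, hrA]
  exact (hr.comp (OrderEmbedding.strictMono (chainEmb ρ))).injective h2

end Chains

end Trisp

/-! ### Equivariant matchings on chains. -/

namespace Trisp

section Toggle

variable {P : Type} [PartialOrder P] {G : Type} [Group G]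

theorem translate_mul {A : G →* (P ≃o P)} (g h : G) (c : Finset P) :
    translate A (g * h) c = translate A g (translate A h c) := by
  rw [translate, translate, translate, Finset.map_map, map_mul]
  rfl

theorem translate_one {A : G →* (P ≃o P)} (c : Finset P) : translate A 1 c = c := by
  rw [translate, map_one]
  exact Finset.map_refl

variable [DecidableEq P]

theorem translate_insert {A : G →* (P ≃o P)} (g : G) (c : Finset P) (t : P) :
    translate A g (insert t c) = insert (A g t) (translate A g c) :=
  Finset.map_insert _ _ _

/-- An equivariant rule `Tog` for adding elements to or removing elements from the chains of a
poset, such that adding and removing are inverse to each other up to the group action. Only chains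
with the property `D` are matched. The `height` orders the matched pairs. -/
structure Toggle (A : G →* (P ≃o P)) (D : Finset P → Prop) (α : Type) [PartialOrder α] where
  height : Finset P → α
  Tog : Finset P → P → Prop
  mem_upward : ∀ {c ρ : Finset P}, c ⊆ ρ → D c → D ρ
  nonempty : ∀ {c : Finset P}, D c → c.Nonempty
  mono : ∀ {c ρ : Finset P}, IsChain (· ≤ ·) (ρ : Set P) → c ⊆ ρ → height c ≤ height ρ
  exists_tog : ∀ {c : Finset P}, IsChain (· ≤ ·) (c : Set P) → D c → ∃ t, Tog c t
  isChain_insert : ∀ {c : Finset P} {t : P}, IsChain (· ≤ ·) (c : Set P) → Tog c t →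
    IsChain (· ≤ ·) ((insert t c : Finset P) : Set P)
  tog_insert : ∀ {c : Finset P} {t : P}, IsChain (· ≤ ·) (c : Set P) → Tog c t → t ∉ c →
    Tog (insert t c) t
  height_insert : ∀ {c : Finset P} {t : P}, IsChain (· ≤ ·) (c : Set P) → Tog c t → t ∉ c →
    height (insert t c) = height c
  height_erase : ∀ {c : Finset P} {t : P}, IsChain (· ≤ ·) (c : Set P) → Tog c t → t ∈ c →
    height (c.erase t) = height c
  mem_erase : ∀ {c : Finset P} {t : P}, IsChain (· ≤ ·) (c : Set P) → D c → Tog c t → t ∈ c →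
    D (c.erase t)
  -- This field makes the matching acyclic: a subchain of the same height admits the same toggle.
  restrict : ∀ {c ρ : Finset P} {t : P}, IsChain (· ≤ ·) (ρ : Set P) → c ⊆ ρ →
    height c = height ρ → Tog ρ t → Tog c t
  unique_of_mem : ∀ {c : Finset P} {t t' : P}, IsChain (· ≤ ·) (c : Set P) → Tog c t → Tog c t' →
    t' ∈ c → t = t'
  -- Several choices are allowed, but they must give the same orbit of enlarged chains.
  unique_orbit : ∀ {c : Finset P} {t t' : P}, IsChain (· ≤ ·) (c : Set P) → Tog c t → Tog c t' →
    ∃ g : G, translate A g c = c ∧ A g t = t'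
  mem_translate : ∀ {c : Finset P} (g : G), D c → D (translate A g c)
  height_translate : ∀ {c : Finset P} (g : G), height (translate A g c) = height c
  tog_translate : ∀ {c : Finset P} {t : P} (g : G), Tog c t → Tog (translate A g c) (A g t)

namespace Toggle

variable {A : G →* (P ≃o P)} {D : Finset P → Prop} {α : Type} [PartialOrder α]
  (X : Toggle A D α)

/-- The chains to which an element is added. -/
def Lower (c : Finset P) : Prop := D c ∧ ∀ t ∈ c, ¬ X.Tog c t

variable {X}

theorem Lower.translate {c : Finset P} (h : X.Lower c) (g : G) :
    X.Lower (Trisp.translate A g c) := by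
  refine ⟨X.mem_translate g h.1, ?_⟩
  rw [forall_mem_translate]
  intro t ht htog
  have := X.tog_translate g⁻¹ htog
  rw [← translate_mul, inv_mul_cancel, translate_one, ← RelIso.mul_apply, ← map_mul,
    inv_mul_cancel, map_one] at this
  exact h.2 t ht this

theorem tog_erase {c : Finset P} {t : P} (hc : IsChain (· ≤ ·) (c : Set P)) (ht : X.Tog c t)
    (htc : t ∈ c) : X.Tog (c.erase t) t :=
  X.restrict hc (Finset.erase_subset _ _) (X.height_erase hc ht htc) ht

/-- A toggled element still present after the removal would have to equal the removed one, by
`unique_of_mem`. -/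
theorem lower_erase {c : Finset P} {t : P} (hc : IsChain (· ≤ ·) (c : Set P)) (hD : D c)
    (ht : X.Tog c t) (htc : t ∈ c) : X.Lower (c.erase t) := by
  refine ⟨X.mem_erase hc hD ht htc, fun t' ht' h => ?_⟩
  have hc' : IsChain (· ≤ ·) ((c.erase t : Finset P) : Set P) :=
    hc.mono (by exact_mod_cast Finset.erase_subset _ _)
  have := X.unique_of_mem hc' (tog_erase hc ht htc) h ht'
  subst this
  simp at ht'

variable (X)

/-- The matching on the cells of the quotient of the nerve given by a toggle. -/
def Match (x y : ((nerve P).quotient (nerveAction A)).Cell) : Prop :=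
  ∃ (k : ℕ) (σ : (nerve P).Simplex k) (τ : (nerve P).Simplex (k + 1)) (t : P),
    orbitCell A σ = x ∧ orbitCell A τ = y ∧ X.Lower (chainSet σ) ∧ X.Tog (chainSet σ) t ∧
      chainSet τ = insert t (chainSet σ)

variable {X}

theorem match_of_chainSet {k m : ℕ} {σ : (nerve P).Simplex k} {τ : (nerve P).Simplex m} {t : P}
    (h : X.Lower (chainSet σ)) (ht : X.Tog (chainSet σ) t)
    (hτ : chainSet τ = insert t (chainSet σ)) : X.Match (orbitCell A σ) (orbitCell A τ) := by
  have hm : m = k + 1 := by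
    have h1 := congrArg Finset.card hτ
    rw [Finset.card_insert_of_notMem (fun hm => h.2 t hm ht), card_chainSet, card_chainSet] at h1
    omega
  subst hm
  exact ⟨k, σ, τ, t, rfl, rfl, h, ht, hτ⟩

/-- By equivariance a matched pair can be represented starting from any representative of its lower
cell; `match_right` does the same for the upper cell. -/
theorem match_left {k : ℕ} {σ : (nerve P).Simplex k}
    {y : ((nerve P).quotient (nerveAction A)).Cell} (h : X.Match (orbitCell A σ) y) :
    ∃ (m : ℕ) (τ : (nerve P).Simplex m) (t : P), orbitCell A τ = y ∧ X.Lower (chainSet σ) ∧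
      X.Tog (chainSet σ) t ∧ chainSet τ = insert t (chainSet σ) := by
  obtain ⟨m, σ', τ, t, h1, h2, h3, h4, h5⟩ := h
  obtain ⟨g, hg⟩ := orbitCell_eq_iff.1 h1
  refine ⟨m + 1, (nerveAction A).act _ g τ, A g t, ?_, hg ▸ h3.translate g,
    hg ▸ X.tog_translate g h4, ?_⟩
  · rw [← h2]
    refine orbitCell_eq_iff.2 ⟨g⁻¹, ?_⟩
    rw [chainSet_act, ← translate_mul, inv_mul_cancel, translate_one]
  · rw [chainSet_act, h5, translate_insert, hg]

theorem match_right {k : ℕ} {τ : (nerve P).Simplex k}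
    {x : ((nerve P).quotient (nerveAction A)).Cell} (h : X.Match x (orbitCell A τ)) :
    ∃ (m : ℕ) (σ : (nerve P).Simplex m) (t : P), orbitCell A σ = x ∧ X.Lower (chainSet σ) ∧
      X.Tog (chainSet σ) t ∧ chainSet τ = insert t (chainSet σ) := by
  obtain ⟨m, σ, τ', t, h1, h2, h3, h4, h5⟩ := h
  obtain ⟨g, hg⟩ := orbitCell_eq_iff.1 h2
  refine ⟨m, (nerveAction A).act _ g σ, A g t, ?_, ?_, ?_, ?_⟩
  · rw [← h1]
    refine orbitCell_eq_iff.2 ⟨g⁻¹, ?_⟩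
    rw [chainSet_act, ← translate_mul, inv_mul_cancel, translate_one]
  · rw [chainSet_act]
    exact h3.translate g
  · rw [chainSet_act]
    exact X.tog_translate g h4
  · rw [chainSet_act, ← hg, h5, translate_insert]

theorem exists_match_of_lower {k : ℕ} {σ : (nerve P).Simplex k} (h : X.Lower (chainSet σ)) :
    ∃ y, X.Match (orbitCell A σ) y := by
  obtain ⟨t, ht⟩ := X.exists_tog (isChain_chainSet σ) h.1
  have htσ : t ∉ chainSet σ := fun hm => h.2 t hm ht
  obtain ⟨τ, hτ⟩ := exists_chainSet_eq (k := k + 1) (X.isChain_insert (isChain_chainSet σ) ht)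
    (by rw [Finset.card_insert_of_notMem htσ, card_chainSet])
  exact ⟨_, match_of_chainSet h ht hτ⟩

theorem exists_match_of_tog {k : ℕ} {τ : (nerve P).Simplex k} (hD : D (chainSet τ)) {t : P}
    (ht : X.Tog (chainSet τ) t) (htτ : t ∈ chainSet τ) :
    ∃ (m : ℕ) (σ : (nerve P).Simplex m), chainSet σ = (chainSet τ).erase t ∧
      X.Match (orbitCell A σ) (orbitCell A τ) := by
  have hc := isChain_chainSet τ
  have hl := lower_erase hc hD ht htτ
  obtain ⟨m, hm⟩ := Nat.exists_eq_succ_of_ne_zero (Finset.card_pos.2 (X.nonempty hl.1)).ne'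
  obtain ⟨σ, hσ⟩ := exists_chainSet_eq (c := (chainSet τ).erase t)
    (hc.mono (by exact_mod_cast Finset.erase_subset _ _)) hm
  refine ⟨m, σ, hσ, match_of_chainSet (t := t) (hσ ▸ hl) (hσ ▸ tog_erase hc ht htτ) ?_⟩
  rw [hσ, Finset.insert_erase htτ]

variable (X)

/-- The height of a cell, with ties broken by the dimension. -/
noncomputable def cellHeight (x : ((nerve P).quotient (nerveAction A)).Cell) : α ×ₗ ℕ :=
  toLex (X.height (chainSet (exists_orbitCell_eq x).choose_spec.choose), x.1)

theorem cellHeight_orbitCell {k : ℕ} (σ : (nerve P).Simplex k) :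
    X.cellHeight (orbitCell A σ) = toLex (X.height (chainSet σ), k) := by
  obtain ⟨g, hg⟩ := orbitCell_eq_iff.1 (exists_orbitCell_eq (orbitCell A σ)).choose_spec.choose_spec
  rw [cellHeight, ← hg, X.height_translate]
  rfl

/-- The quotient of the nerve collapses onto the subtrisp of the cells that are not matched. -/
theorem collapsesOnto (X : Toggle A D α) [Finite P] {r : P → ℕ} (hr : StrictMono r)
    (hrA : ∀ g p, r (A g p) = r p) (L : ((nerve P).quotient (nerveAction A)).Subtrisp)
    (hL : ∀ (k : ℕ) (σ : (nerve P).Simplex k), orbitCell A σ ∈ L.carrier ↔ ¬ D (chainSet σ)) :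
    ((nerve P).quotient (nerveAction A)).CollapsesOnto L := by
  refine collapsesOnto_of_matching L X.cellHeight X.Match ?_ ?_ ?_ ?_ ?_ ?_ ?_
  · rintro x y ⟨k, σ, τ, t, rfl, rfl, -, -, h⟩
    refine ⟨k, _, _, rfl, rfl, ?_⟩
    obtain ⟨f, hf⟩ := exists_face_eq_iff.2 (h ▸ Finset.subset_insert t _ : chainSet σ ⊆ chainSet τ)
    have hf' : ((nerve P).quotient (nerveAction A)).face f (orbitCell A τ).2 =
        (orbitCell A σ).2 := congrArg (Quotient.mk ((nerveAction A).orbitRel k)) hf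
    exact ⟨f, hf', fun f' h' => face_quotient_injective hr hrA _ (h'.trans hf'.symm)⟩
  · rintro x y y' ⟨k, σ, τ, t, rfl, rfl, hl, ht, h⟩ h'
    obtain ⟨m, τ', t', rfl, -, ht', h'⟩ := match_left h'
    obtain ⟨g, hg, hgt⟩ := X.unique_orbit (isChain_chainSet σ) ht ht'
    refine orbitCell_eq_iff.2 ⟨g, ?_⟩
    rw [h, h', translate_insert, hg, hgt]
  · rintro x x' y ⟨k, σ, τ, t, rfl, rfl, hl, ht, h⟩ h'
    obtain ⟨m, σ', t', rfl, hl', ht', h'⟩ := match_right h'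
    have htσ : t ∉ chainSet σ := fun hm => hl.2 t hm ht
    have htσ' : t' ∉ chainSet σ' := fun hm => hl'.2 t' hm ht'
    have h1 := X.tog_insert (isChain_chainSet σ) ht htσ
    have h2 := X.tog_insert (isChain_chainSet σ') ht' htσ'
    rw [← h] at h1
    rw [← h'] at h2
    -- Both elements are toggled in the same chain and already lie in it, so no freedom of choice is
    -- left.
    have htt : t = t' :=
      X.unique_of_mem (isChain_chainSet τ) h1 h2 (h' ▸ Finset.mem_insert_self _ _)
    subst htt
    refine orbitCell_eq_iff.2 ⟨1, ?_⟩
    rw [translate_one, ← Finset.erase_insert htσ, ← h, h', Finset.erase_insert htσ']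
  · rintro x y z h ⟨k, σ, τ, t, rfl, rfl, hl, ht, hτ⟩
    obtain ⟨m, τ', t', -, hl', -, -⟩ := match_left h
    refine hl'.2 t (hτ ▸ Finset.mem_insert_self _ _) ?_
    rw [hτ]
    exact X.tog_insert (isChain_chainSet σ) ht fun hm => hl.2 t hm ht
  · rintro x y ⟨k, σ, τ, t, rfl, rfl, hl, -, -⟩ h
    exact (hL k σ).1 h hl.1
  · intro x hx
    obtain ⟨k, σ, rfl⟩ := exists_orbitCell_eq x
    have hD : D (chainSet σ) := by
      by_contra h
      exact hx ((hL k σ).2 h)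
    by_cases h : ∃ t ∈ chainSet σ, X.Tog (chainSet σ) t
    · obtain ⟨t, htσ, ht⟩ := h
      obtain ⟨m, ρ, -, hρ⟩ := exists_match_of_tog hD ht htσ
      exact Or.inr ⟨_, hρ⟩
    · exact Or.inl (exists_match_of_lower ⟨hD, fun t ht h' => h ⟨t, ht, h'⟩⟩)
  · intro x y hxy z hz
    obtain ⟨k, σ, rfl⟩ := exists_orbitCell_eq x
    obtain ⟨m, τ, t, rfl, hl, ht, hτ⟩ := match_left hxy
    obtain ⟨l, ρ, rfl, hρ⟩ := isFace_orbitCell hz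
    have hDρ := X.mem_upward hρ hl.1
    have hmono := X.mono (isChain_chainSet ρ) hρ
    simp only [cellHeight_orbitCell]
    by_cases h : ∃ t ∈ chainSet ρ, X.Tog (chainSet ρ) t
    · obtain ⟨t', htρ, ht'⟩ := h
      obtain ⟨j, π, hπ, hπρ⟩ := exists_match_of_tog hDρ ht' htρ
      have hh := X.height_erase (isChain_chainSet ρ) ht' htρ
      rw [← hπ] at hh
      rcases hmono.lt_or_eq with hlt | heq
      · refine Or.inr (Or.inr (Or.inr ⟨_, hπρ, ?_⟩))
        rw [cellHeight_orbitCell, hh]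
        exact Prod.Lex.toLex_lt_toLex.2 (Or.inl hlt)
      -- At equal height `t'` is toggled in `σ` too. As `σ` is a lower chain it does not contain
      -- `t'`, hence `σ` lies in the partner of `ρ`.
      · have htσ := X.restrict (isChain_chainSet ρ) hρ heq ht'
        have hn : t' ∉ chainSet σ := fun hm => hl.2 t' hm htσ
        have hsub : chainSet σ ⊆ chainSet π := by
          rw [hπ]
          exact Finset.subset_erase.2 ⟨hρ, hn⟩
        rcases hsub.eq_or_ssubset with he | hss
        · refine Or.inr (Or.inl ?_)
          -- Here `ρ` and `τ` extend `σ` by two admissible choices, so they represent the same cell.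
          obtain ⟨g, hg, hgt⟩ := X.unique_orbit (isChain_chainSet σ) htσ ht
          refine orbitCell_eq_iff.2 ⟨g, ?_⟩
          rw [← Finset.insert_erase htρ, ← hπ, ← he, translate_insert, hg, hgt, hτ]
        · refine Or.inr (Or.inr (Or.inr ⟨_, hπρ, ?_⟩))
          rw [cellHeight_orbitCell, hh]
          refine Prod.Lex.toLex_lt_toLex.2 (Or.inr ⟨heq, ?_⟩)
          have := Finset.card_lt_card hss
          rw [card_chainSet, card_chainSet] at this
          change k < j
          omega
    · rcases hρ.eq_or_ssubset with he | hss
      · exact Or.inl (orbitCell_eq_iff.2 ⟨1, by rw [translate_one, he]⟩)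
      · obtain ⟨y, hy⟩ := exists_match_of_lower (A := A) (σ := ρ)
          ⟨hDρ, fun t ht h' => h ⟨t, ht, h'⟩⟩
        refine Or.inr (Or.inr (Or.inl ⟨y, hy, Prod.Lex.toLex_lt_toLex.2 ?_⟩))
        rcases hmono.lt_or_eq with hlt | heq
        · exact Or.inl hlt
        · refine Or.inr ⟨heq, ?_⟩
          have := Finset.card_lt_card hss
          rw [card_chainSet, card_chainSet] at this
          change k < l
          omega

end Toggle

end Toggle

end Trisp

namespace Trisp

theorem exists_maximum_of_isChain {P : Type} [PartialOrder P] {c : Finset P}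
    (hc : IsChain (· ≤ ·) (c : Set P)) {q : P → Prop} (h : ∃ y ∈ c, q y) :
    ∃ y ∈ c, q y ∧ ∀ y' ∈ c, q y' → y' ≤ y := by
  classical
  obtain ⟨y, hy⟩ := (c.filter q).exists_maximal (by simpa [Finset.Nonempty] using h)
  have hy' := Finset.mem_filter.1 hy.1
  refine ⟨y, hy'.1, hy'.2, fun y' h1 h2 => ?_⟩
  rcases hc.total h1 hy'.1 with h3 | h3
  · exact h3
  · exact hy.2 (Finset.mem_filter.2 ⟨h1, h2⟩) h3

theorem isChain_insert_of_comparable {P : Type} [PartialOrder P] [DecidableEq P] {c : Finset P}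
    {t : P} (hc : IsChain (· ≤ ·) (c : Set P)) (h : ∀ x ∈ c, x ≤ t ∨ t ≤ x) :
    IsChain (· ≤ ·) ((insert t c : Finset P) : Set P) := by
  rw [Finset.coe_insert]
  exact hc.insert fun x hx _ => (h x hx).symm

/-! ### The rank of the largest element with a property. -/

section Maximum

variable {P : Type} (r : P → ℕ) (q : P → Prop)

open Classical in
/-- The maximal value of `r x + 1` for the elements `x` of `c` with property `q`, and `0` if there
are none. -/
noncomputable def topRank (c : Finset P) : ℕ := (c.filter q).sup fun x => r x + 1

variable {r q}

theorem topRank_mono {c ρ : Finset P} (h : c ⊆ ρ) : topRank r q c ≤ topRank r q ρ :=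
  Finset.sup_mono (by classical exact Finset.filter_subset_filter _ h)

theorem topRank_insert [DecidableEq P] {c : Finset P} {t : P} (h : ¬ q t) :
    topRank r q (insert t c) = topRank r q c := by
  rw [topRank, topRank, Finset.filter_insert, if_neg h]

variable [PartialOrder P]

theorem topRank_eq (hr : Monotone r) {c : Finset P} {y : P} (hy : y ∈ c) (hq : q y)
    (h : ∀ y' ∈ c, q y' → y' ≤ y) : topRank r q c = r y + 1 := by
  classical
  refine le_antisymm (Finset.sup_le fun y' h' => ?_) ?_
  · rw [Finset.mem_filter] at h'
    exact Nat.succ_le_succ (hr (h y' h'.1 h'.2))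
  · exact Finset.le_sup (f := fun x => r x + 1) (Finset.mem_filter.2 ⟨hy, hq⟩)

theorem mem_of_topRank_eq (hr : StrictMono r) {c ρ : Finset P} (hcρ : c ⊆ ρ) {y : P} (hy : y ∈ ρ)
    (hq : q y) (h : ∀ y' ∈ ρ, q y' → y' ≤ y) (heq : topRank r q c = topRank r q ρ) : y ∈ c := by
  classical
  rw [topRank_eq hr.monotone hy hq h] at heq
  -- The shift by one in `topRank` separates the empty filter, with value `0`, from an element of
  -- rank `0`.
  have hne : (c.filter q).Nonempty := by
    by_contra hne
    rw [Finset.not_nonempty_iff_eq_empty] at hne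
    rw [topRank, hne] at heq
    simp at heq
  obtain ⟨x, hx, hx'⟩ := Finset.exists_mem_eq_sup _ hne fun x => r x + 1
  rw [Finset.mem_filter] at hx
  have h1 : x ≤ y := h x (hcρ hx.1) hx.2
  have h2 : r x + 1 = r y + 1 := hx'.symm.trans heq
  rcases h1.lt_or_eq with h3 | h3
  · have := hr h3
    omega
  · exact h3 ▸ hx.1

theorem topRank_translate {G : Type} [Group G] {A : G →* (P ≃o P)} (g : G) (c : Finset P)
    (hr : ∀ p, r (A g p) = r p) {q' : P → Prop} (hq : ∀ p ∈ c, q' (A g p) ↔ q p) :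
    topRank r q' (translate A g c) = topRank r q c := by
  classical
  have h : (translate A g c).filter q' = translate A g (c.filter q) := by
    rw [translate, translate, Finset.filter_map]
    exact congrArg _ (Finset.filter_congr fun p hp => hq p hp)
  rw [topRank, h, topRank, translate, Finset.sup_map]
  exact Finset.sup_congr rfl fun p _ => congrArg (· + 1) (hr p)

end Maximum

/-! ### Collapsing along a closure operator. -/

section Galois

variable {P Q : Type} [PartialOrder P] [PartialOrder Q] {G : Type} [Group G]
  {A : G →* (P ≃o P)} {B : G →* (Q ≃o Q)} {j : Q ↪o P} {R : P → Q}

/-- A left adjoint is determined by its right adjoint. One inequality holds for every group element;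
applied to the inverse, it gives the other. -/
theorem equivariant_of_galois (hR : ∀ s x, R s ≤ x ↔ s ≤ j x)
    (hj : ∀ g x, j (B g x) = A g (j x)) (g : G) (s : P) : R (A g s) = B g (R s) := by
  have h1 : ∀ g s, R (A g s) ≤ B g (R s) := fun g s => by
    rw [hR, hj]
    exact (A g).monotone ((hR _ _).1 le_rfl)
  refine le_antisymm (h1 g s) ?_
  have h2 := (B g).monotone (h1 g⁻¹ (A g s))
  rwa [← RelIso.mul_apply, ← map_mul, inv_mul_cancel, map_one, ← RelIso.mul_apply (B g),
    ← map_mul, mul_inv_cancel, map_one] at h2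

theorem act_mem_range_iff (hj : ∀ g x, j (B g x) = A g (j x)) (g : G) (s : P) :
    A g s ∈ Set.range j ↔ s ∈ Set.range j := by
  constructor
  · rintro ⟨x, hx⟩
    refine ⟨B g⁻¹ x, ?_⟩
    rw [hj, hx, ← RelIso.mul_apply, ← map_mul, inv_mul_cancel, map_one]
    rfl
  · rintro ⟨x, rfl⟩
    exact ⟨B g x, hj g x⟩

/-- The toggle belonging to the closure operator of an equivariant Galois insertion: it adds or
removes the closure of the largest element that is not closed. -/
noncomputable def galoisToggle [DecidableEq P] (hR : ∀ s x, R s ≤ x ↔ s ≤ j x)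
    (hj : ∀ g x, j (B g x) = A g (j x)) {r : P → ℕ} (hr : StrictMono r)
    (hrA : ∀ g p, r (A g p) = r p) :
    Toggle A (fun c => ∃ y ∈ c, y ∉ Set.range j) ℕ where
  height := topRank r (· ∉ Set.range j)
  Tog c t := ∃ y ∈ c, y ∉ Set.range j ∧ (∀ y' ∈ c, y' ∉ Set.range j → y' ≤ y) ∧ t = j (R y)
  mem_upward := fun h ⟨y, hy, hy'⟩ => ⟨y, h hy, hy'⟩
  nonempty := fun ⟨y, hy, _⟩ => ⟨y, hy⟩
  mono _ h := topRank_mono h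
  exists_tog := by
    intro c hc h
    obtain ⟨y, h1, h2, h3⟩ := exists_maximum_of_isChain hc h
    exact ⟨_, y, h1, h2, h3, rfl⟩
  isChain_insert := by
    rintro c _ hc ⟨y, h1, h2, h3, rfl⟩
    -- Closed elements above `y` lie above its closure; every other element of the chain lies below
    -- `y`.
    refine isChain_insert_of_comparable hc fun x hx => ?_
    have hy : y ≤ j (R y) := (hR _ _).1 le_rfl
    by_cases hx' : x ∈ Set.range j
    · rcases hc.total hx h1 with h | h
      · exact Or.inl (h.trans hy)
      · obtain ⟨x, rfl⟩ := hx'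
        exact Or.inr (j.monotone ((hR _ _).2 h))
    · exact Or.inl ((h3 x hx hx').trans hy)
  tog_insert := by
    rintro c _ hc ⟨y, h1, h2, h3, rfl⟩ -
    refine ⟨y, Finset.mem_insert_of_mem h1, h2, fun y' hy' h' => ?_, rfl⟩
    rcases Finset.mem_insert.1 hy' with rfl | hy'
    · exact absurd ⟨_, rfl⟩ h'
    · exact h3 y' hy' h'
  height_insert := by
    rintro c _ hc ⟨y, h1, h2, h3, rfl⟩ -
    -- The added element is closed, so it does not count for the height.
    exact topRank_insert (by simp)
  height_erase := by
    rintro c _ hc ⟨y, h1, h2, h3, rfl⟩ h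
    conv_rhs => rw [← Finset.insert_erase h]
    exact (topRank_insert (by simp)).symm
  mem_erase := by
    rintro c _ hc - ⟨y, h1, h2, h3, rfl⟩ -
    refine ⟨y, Finset.mem_erase.2 ⟨?_, h1⟩, h2⟩
    rintro h
    exact h2 ⟨_, h.symm⟩
  restrict := by
    rintro c ρ _ - hcρ h ⟨y, h1, h2, h3, rfl⟩
    exact ⟨y, mem_of_topRank_eq hr hcρ h1 h2 h3 h, h2, fun y' hy' => h3 y' (hcρ hy'), rfl⟩
  unique_of_mem := by
    rintro c _ _ - ⟨y, h1, h2, h3, rfl⟩ ⟨y', h1', h2', h3', rfl⟩ -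
    rw [(h3' y h1 h2).antisymm (h3 y' h1' h2')]
  unique_orbit := by
    rintro c _ _ - ⟨y, h1, h2, h3, rfl⟩ ⟨y', h1', h2', h3', rfl⟩
    refine ⟨1, translate_one c, ?_⟩
    rw [(h3' y h1 h2).antisymm (h3 y' h1' h2'), map_one]
    rfl
  mem_translate := by
    rintro c g h
    rw [exists_mem_translate]
    simpa only [act_mem_range_iff hj] using h
  height_translate g := topRank_translate g _ (hrA g) fun p _ => by rw [act_mem_range_iff hj]
  tog_translate := by
    rintro c _ g ⟨y, h1, h2, h3, rfl⟩
    refine ⟨A g y, mem_translate.2 h1, by rwa [act_mem_range_iff hj], ?_, ?_⟩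
    · rw [forall_mem_translate]
      intro y' hy' h'
      rw [act_mem_range_iff hj] at h'
      exact (A g).monotone (h3 y' hy' h')
    · rw [equivariant_of_galois hR hj, hj]

/-- An equivariant Galois insertion induces a collapse of the quotients of the nerves. -/
theorem collapsesOnto_range_of_galois [Finite P] (hR : ∀ s x, R s ≤ x ↔ s ≤ j x)
    (hj : ∀ g x, j (B g x) = A g (j x)) {r : P → ℕ} (hr : StrictMono r)
    (hrA : ∀ g p, r (A g p) = r p)
    (hF : ∀ (k : ℕ) (g : G) (σ : (nerve Q).Simplex k),
      (nerveMap j).toFun ((nerveAction B).act k g σ) =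
        (nerveAction A).act k g ((nerveMap j).toFun σ)) :
    ((nerve P).quotient (nerveAction A)).CollapsesOnto
      ((nerveMap j).quotientMap (nerveAction B) (nerveAction A) hF).range := by
  classical
  refine (galoisToggle hR hj hr hrA).collapsesOnto hr hrA _ fun k σ => ?_
  simp only [not_exists, not_and, not_not]
  constructor
  · rintro ⟨x, h⟩ y hy
    obtain ⟨τ, rfl⟩ : ∃ τ : (nerve Q).Simplex k, Quotient.mk _ τ = x := Quotient.exists_rep x
    obtain ⟨g, hg⟩ : ∃ g, (nerveAction A).act k g ((nerveMap j).toFun τ) = σ := Quotient.exact h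
    rw [← hg, chainSet_act] at hy
    revert y
    rw [forall_mem_translate]
    intro p hp
    obtain ⟨i, rfl⟩ := (mem_chainSet _).1 hp
    rw [act_mem_range_iff hj]
    exact ⟨chainEmb τ i, rfl⟩
  · intro h
    choose f hf using fun i => h _ ((mem_chainSet σ).2 ⟨i, rfl⟩)
    let τ : Fin (k + 1) ↪o Q := OrderEmbedding.ofMapLEIff f fun a b => by
      rw [← j.le_iff_le, hf, hf, OrderEmbedding.le_iff_le]
    have hτ : (nerveMap j).toFun (τ : (nerve Q).Simplex k) = σ := RelEmbedding.ext hf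
    exact ⟨Quotient.mk ((nerveAction B).orbitRel k) τ,
      congrArg (Quotient.mk ((nerveAction A).orbitRel k)) hτ⟩

theorem quotientMap_nerveMap_injective (hj : ∀ g x, j (B g x) = A g (j x))
    (hF : ∀ (k : ℕ) (g : G) (σ : (nerve Q).Simplex k),
      (nerveMap j).toFun ((nerveAction B).act k g σ) =
        (nerveAction A).act k g ((nerveMap j).toFun σ)) (k : ℕ) :
    Function.Injective (((nerveMap j).quotientMap (nerveAction B) (nerveAction A) hF).toFun :
      ((nerve Q).quotient (nerveAction B)).Simplex k → _) := by
  rintro ⟨σ⟩ ⟨τ⟩ h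
  obtain ⟨g, hg⟩ := Quotient.exact h
  refine Quotient.sound ⟨g, RelEmbedding.ext fun i => j.injective ?_⟩
  exact (hj _ _).trans (DFunLike.congr_fun (F := Fin (k + 1) ↪o P) hg i)

end Galois

end Trisp

/-! ### Transitive closures of graphs -/

/-- The partition into the connected components of a disconnected graph. -/
def componentPartition {n : ℕ} [NeZero n] (s : FacePoset (DG n)) : ProperPartition n :=
  ⟨(SimpleGraph.fromEdgeSet (s.1 : Set (Sym2 (Fin n)))).reachableSetoid, by
    obtain ⟨⟨e, he⟩, h1, h2⟩ := mem_DG_iff.1 s.2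
    constructor
    · intro h
      induction e with
      | _ x y =>
        have hne : x ≠ y := by simpa using h1 _ he
        have : (SimpleGraph.fromEdgeSet (s.1 : Set (Sym2 (Fin n)))).reachableSetoid x y :=
          SimpleGraph.Adj.reachable ((SimpleGraph.fromEdgeSet_adj _).2 ⟨he, hne⟩)
        rw [h] at this
        exact hne this
    · intro h
      refine h2 ⟨fun x y => ?_⟩
      have : (SimpleGraph.fromEdgeSet (s.1 : Set (Sym2 (Fin n)))).reachableSetoid x y := by
        rw [h]
        trivial
      exact this⟩

/-- Taking components is left adjoint to the embedding: a graph has all its edges inside blocks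
exactly when all its walks stay inside blocks. -/
theorem componentPartition_le_iff {n : ℕ} [NeZero n] (s : FacePoset (DG n))
    (x : ProperPartition n) : componentPartition s ≤ x ↔ s ≤ partitionEmbedding n x := by
  constructor
  · intro h e he
    induction e with
    | _ a b =>
      have hne : a ≠ b := by simpa using (mem_DG_iff.1 s.2).2.1 _ he
      refine mem_blockEdges.2 ⟨hne, h ?_⟩
      exact SimpleGraph.Adj.reachable ((SimpleGraph.fromEdgeSet_adj _).2 ⟨he, hne⟩)
  · rintro h a b ⟨w⟩
    induction w with
    | nil => exact x.1.refl' _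
    | cons hadj _ ih =>
      rw [SimpleGraph.fromEdgeSet_adj] at hadj
      exact x.1.trans' (mem_blockEdges.1 (h hadj.1)).2 ih

instance (n : ℕ) : Finite (FacePoset (DG n)) := Subtype.finite

instance (n : ℕ) : Finite (ProperPartition n) :=
  Finite.of_injective _ (partitionEmbedding n).injective

theorem bdDGQuotient_collapsesOnto_range (n : ℕ) [NeZero n] :
    (bdDGQuotient n).CollapsesOnto (partitionQuotientMap n).range :=
  Trisp.collapsesOnto_range_of_galois componentPartition_le_iff partitionEmbedding_equivariant
    -- The number of edges is the invariant rank.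
    (r := fun s => s.1.card) (fun _ _ h => Finset.card_lt_card h)
    (fun _ _ => Finset.card_map _) _

theorem partitionQuotientMap_injective (n k : ℕ) :
    Function.Injective
      ((partitionQuotientMap n).toFun : (partitionQuotient n).Simplex k → _) :=
  Trisp.quotientMap_nerveMap_injective partitionEmbedding_equivariant _ k

/-! ### Partitions and their nontrivial points -/

namespace Setoid

variable {α : Type}

/-- The points whose block is not a singleton. -/
def support (r : Setoid α) : Set α := {a | ∃ b, b ≠ a ∧ r a b}

/-- The partition that agrees with `r` on `X` and has singleton blocks elsewhere. -/
def restrictTo (X : Set α) (r : Setoid α) : Setoid α where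
  r a b := a = b ∨ (a ∈ X ∧ b ∈ X ∧ r a b)
  iseqv :=
    { refl := fun _ => Or.inl rfl
      symm := by
        rintro a b (rfl | ⟨h1, h2, h3⟩)
        · exact Or.inl rfl
        · exact Or.inr ⟨h2, h1, r.symm' h3⟩
      trans := by
        rintro a b c (rfl | ⟨h1, h2, h3⟩) (rfl | ⟨h4, h5, h6⟩)
        · exact Or.inl rfl
        · exact Or.inr ⟨h4, h5, h6⟩
        · exact Or.inr ⟨h1, h2, h3⟩
        · exact Or.inr ⟨h1, h5, r.trans' h3 h6⟩ }

/-- There are no singleton blocks. -/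
def Full (r : Setoid α) : Prop := ∀ a, a ∈ r.support

/-- Every block of `w` contains at most two points of the support of `r`. -/
def Thin (w r : Setoid α) : Prop :=
  ∀ a ∈ r.support, ∀ b ∈ r.support, ∀ c ∈ r.support, w a b → w a c → a = b ∨ a = c ∨ b = c

/-- The nontrivial points of `y` in a block of `z` form one block of `y`. -/
def ClosedIn (z y : Setoid α) : Prop := ∀ a ∈ y.support, ∀ b ∈ y.support, z a b → y a b

/-- The partition `t` refines `v` and its nontrivial blocks are pairs, one in every block of `w`
that contains a nontrivial block of `v`. -/
structure IsTransversal (v w t : Setoid α) : Prop where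
  le : t ≤ v
  thin : Thin w t
  meets : ∀ a ∈ v.support, ∃ b ∈ t.support, w a b

theorem restrictTo_apply {X : Set α} {r : Setoid α} {a b : α} :
    restrictTo X r a b ↔ a = b ∨ (a ∈ X ∧ b ∈ X ∧ r a b) := Iff.rfl

theorem mem_support_right {r : Setoid α} {a b : α} (h : r a b) (hne : a ≠ b) : b ∈ r.support :=
  ⟨a, hne, r.symm' h⟩

theorem mem_support_left {r : Setoid α} {a b : α} (h : r a b) (hne : a ≠ b) : a ∈ r.support :=
  ⟨b, hne.symm, h⟩

theorem support_mono {r s : Setoid α} (h : r ≤ s) : r.support ⊆ s.support :=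
  fun _ ⟨b, hne, hb⟩ => ⟨b, hne, h hb⟩

theorem support_bot : (⊥ : Setoid α).support = ∅ := by
  ext a
  simp only [support, Set.mem_ofPred_eq, Set.mem_empty_iff_false, iff_false, not_exists, not_and]
  intro b hne h
  exact hne (show a = b from h).symm

theorem support_nonempty_iff {r : Setoid α} : r.support.Nonempty ↔ r ≠ ⊥ := by
  constructor
  · rintro h rfl
    rw [support_bot] at h
    exact Set.not_nonempty_empty h
  · intro h
    by_contra hne
    refine h (Setoid.ext fun a b => ⟨fun hab => ?_, ?_⟩)
    · by_contra hab'
      exact hne ⟨a, mem_support_left hab hab'⟩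
    · rintro rfl
      exact r.refl' a

theorem support_restrictTo {y z : Setoid α} (h : y ≤ z) :
    (restrictTo y.support z).support = y.support := by
  ext a
  constructor
  · rintro ⟨b, hne, hb | hb⟩
    · exact absurd hb.symm hne
    · exact hb.1
  · rintro ⟨b, hne, hb⟩
    exact ⟨b, hne, Or.inr ⟨⟨b, hne, hb⟩, mem_support_right hb hne.symm, h hb⟩⟩

theorem le_restrictTo {y z : Setoid α} (h : y ≤ z) : y ≤ restrictTo y.support z := by
  intro a b hab
  by_cases hne : a = b
  · exact Or.inl hne
  · exact Or.inr ⟨mem_support_left hab hne, mem_support_right hab hne, h hab⟩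

theorem restrictTo_le (X : Set α) (r : Setoid α) : restrictTo X r ≤ r := by
  rintro a b (rfl | h)
  · exact r.refl' a
  · exact h.2.2

theorem closedIn_restrictTo {y z : Setoid α} (h : y ≤ z) :
    ClosedIn z (restrictTo y.support z) := by
  intro a ha b hb hab
  rw [support_restrictTo h] at ha hb
  exact Or.inr ⟨ha, hb, hab⟩

/-- With `le_restrictTo` and `closedIn_restrictTo`, this makes `restrictTo y.support z` the least
partition above `y` that is closed in `z`, for `y ≤ z`. -/
theorem restrictTo_support_le {x y z : Setoid α} (h : y ≤ x) (hx : ClosedIn z x) :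
    restrictTo y.support z ≤ x := by
  rintro a b (rfl | ⟨ha, hb, hab⟩)
  · exact x.refl' a
  · exact hx a (support_mono h ha) b (support_mono h hb) hab

theorem closedIn_of_le {y z : Setoid α} (h : z ≤ y) : ClosedIn z y := fun _ _ _ _ hab => h hab

/-- Thinness, like fullness, depends on the second partition only through its support. -/
theorem Thin.mono {w r s : Setoid α} (h : Thin w s) (hrs : r.support ⊆ s.support) : Thin w r :=
  fun a ha b hb c hc => h a (hrs ha) b (hrs hb) c (hrs hc)

theorem Thin.anti {w w' r : Setoid α} (h : Thin w' r) (hw : w ≤ w') : Thin w r :=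
  fun a ha b hb c hc hab hac => h a ha b hb c hc (hw hab) (hw hac)

theorem Full.mono {r s : Setoid α} (h : Full r) (hrs : r ≤ s) : Full s :=
  fun a => support_mono hrs (h a)

theorem thin_bot (w : Setoid α) : Thin w ⊥ := by
  intro a ha
  rw [support_bot] at ha
  exact absurd ha (Set.notMem_empty a)

theorem full_top [Nontrivial α] : Full (⊤ : Setoid α) := fun a => by
  obtain ⟨b, hb⟩ := exists_ne a
  exact ⟨b, hb, trivial⟩

/-- The `t`-partner of `a` lies in the same block of `w`, so by thinness any further nontrivial
point there is `a` or that partner. -/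
theorem IsTransversal.closedIn {v w t : Setoid α} (h : IsTransversal v w t) (hvw : v ≤ w) :
    ClosedIn w t := by
  rintro a ⟨a', hne, ha'⟩ b hb hab
  rcases h.thin a ⟨a', hne, ha'⟩ b hb a' (mem_support_right ha' hne.symm) hab
    (hvw (h.le ha')) with rfl | rfl | rfl
  · exact t.refl' a
  · exact absurd rfl hne
  · exact ha'

/-- Comparable transversals are equal. -/
theorem IsTransversal.eq_of_le {v w t t' : Setoid α} (h : IsTransversal v w t)
    (h' : IsTransversal v w t') (hvw : v ≤ w) (hle : t.support ⊆ t'.support) : t = t' := by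
  have hc := h.closedIn hvw
  have hc' := h'.closedIn hvw
  refine le_antisymm (fun a b hab => ?_) fun a b hab => ?_
  · by_cases hne : a = b
    · exact hne ▸ t'.refl' a
    · exact hc' a (hle (mem_support_left hab hne)) b (hle (mem_support_right hab hne))
        (hvw (h.le hab))
  · by_cases hne : a = b
    · exact hne ▸ t.refl' a
    have ha := mem_support_left hab hne
    have hb := mem_support_right hab hne
    -- The pair `c`, `d` of `t` in the `w`-block of `a` also consists of nontrivial points of `t'`;
    -- thinness of `t'` forces it to be the pair `a`, `b`.
    obtain ⟨c, hct, hac⟩ := h.meets a (support_mono h'.le ha)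
    obtain ⟨d, hdc, hcd⟩ := hct
    have hct' := hle (mem_support_left hcd hdc.symm)
    have hdt' := hle (mem_support_right hcd hdc.symm)
    have wab : w a b := hvw (h'.le hab)
    have wcd : w c d := hvw (h.le hcd)
    have wca : w c a := w.symm' hac
    have wcb : w c b := w.trans' wca wab
    rcases h'.thin c hct' d hdt' a ha wcd wca with e | e | e <;>
    rcases h'.thin c hct' d hdt' b hb wcd wcb with e' | e' | e'
    · exact absurd e.symm hdc
    · exact absurd e.symm hdc
    · exact absurd e.symm hdc
    · exact absurd e'.symm hdc
    · exact absurd (e.symm.trans e') hne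
    · rwa [← e, ← e']
    · exact absurd e'.symm hdc
    · rw [← e, ← e']
      exact t.symm' hcd
    · exact absurd (e.symm.trans e') hne

/-- Keep the nontrivial points of `q`, choose two `v`-equivalent points in each block of `w` that
meets the support of `v` but not that of `q`, and restrict `v` to all these points. -/
theorem exists_isTransversal {v w q : Setoid α} (hvw : v ≤ w) (hqv : q ≤ v) (hq : Thin w q) :
    ∃ t, IsTransversal v w t ∧ q ≤ t := by
  have hex : ∀ C : {C : Quotient w // ∃ a ∈ v.support, Quotient.mk w a = C},
      ∃ a b, Quotient.mk w a = C.1 ∧ b ≠ a ∧ v a b := by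
    rintro ⟨_, a, ⟨b, hne, hb⟩, rfl⟩
    exact ⟨a, b, rfl, hne, hb⟩
  choose f g hf hne hfg using hex
  have hg : ∀ C, Quotient.mk w (g C) = C.1 := fun C => by
    rw [← hf C]
    exact Quotient.sound (w.symm' (hvw (hfg C)))
  let X : Set α := q.support ∪
    {x | ∃ C, (∀ d ∈ q.support, Quotient.mk w d ≠ C.1) ∧ (x = f C ∨ x = g C)}
  have hX : ∀ x ∈ X, ∃ y ∈ X, y ≠ x ∧ v x y := by
    rintro x (⟨y, hyx, hxy⟩ | ⟨C, hC, rfl | rfl⟩)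
    · exact ⟨y, Or.inl (mem_support_right hxy hyx.symm), hyx, hqv hxy⟩
    · exact ⟨g C, Or.inr ⟨C, hC, Or.inr rfl⟩, hne C, hfg C⟩
    · exact ⟨f C, Or.inr ⟨C, hC, Or.inl rfl⟩, (hne C).symm, v.symm' (hfg C)⟩
  have hsupp : (restrictTo X v).support = X := by
    ext x
    constructor
    · rintro ⟨y, hyx, hxy | hxy⟩
      · exact absurd hxy.symm hyx
      · exact hxy.1
    · intro hx
      obtain ⟨y, hy, hyx, hxy⟩ := hX x hx
      exact ⟨y, hyx, Or.inr ⟨hx, hy, hxy⟩⟩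
  refine ⟨restrictTo X v, ⟨restrictTo_le _ _, ?_, ?_⟩, ?_⟩
  · intro a ha b hb c hc hab hac
    rw [hsupp] at ha hb hc
    have eab : Quotient.mk w a = Quotient.mk w b := Quotient.sound hab
    have eac : Quotient.mk w a = Quotient.mk w c := Quotient.sound hac
    have key : ∀ {C : {C : Quotient w // ∃ a ∈ v.support, Quotient.mk w a = C}} {x : α},
        x = f C ∨ x = g C → Quotient.mk w x = C.1 := by
      rintro C x (rfl | rfl)
      · exact hf C
      · exact hg C
    rcases ha with ha | ⟨C, hC, ha⟩
    · have h1 : ∀ x ∈ X, Quotient.mk w a = Quotient.mk w x → x ∈ q.support := by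
        rintro x (hx | ⟨C, hC, hx⟩) hax
        · exact hx
        · exact absurd (hax.trans (key hx)) (hC a ha)
      exact hq a ha b (h1 b hb eab) c (h1 c hc eac) hab hac
    · have h1 : ∀ x ∈ X, Quotient.mk w a = Quotient.mk w x → x = f C ∨ x = g C := by
        rintro x (hx | ⟨C', hC', hx⟩) hax
        · exact absurd (hax.symm.trans (key ha)) (hC x hx)
        · have : C' = C := Subtype.ext ((key hx).symm.trans (hax.symm.trans (key ha)))
          exact this ▸ hx
      rcases ha with ha | ha <;> rcases h1 b hb eab with hb | hb <;>
        rcases h1 c hc eac with hc | hc <;> simp [ha, hb, hc]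
  · intro a ha
    rw [hsupp]
    by_cases h : ∃ d ∈ q.support, Quotient.mk w d = Quotient.mk w a
    · obtain ⟨d, hd, hda⟩ := h
      exact ⟨d, Or.inl hd, w.symm' (Quotient.exact hda)⟩
    · let C : {C : Quotient w // ∃ a ∈ v.support, Quotient.mk w a = C} := ⟨_, a, ha, rfl⟩
      exact ⟨f C, Or.inr ⟨C, fun d hd he => h ⟨d, hd, he⟩, Or.inl rfl⟩,
        w.symm' (Quotient.exact (hf C))⟩
  · intro a b hab
    by_cases hne : a = b
    · exact Or.inl hne
    · exact Or.inr ⟨Or.inl (mem_support_left hab hne), Or.inl (mem_support_right hab hne), hqv hab⟩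

/-! ### Relabelling -/

/-- The action of a permutation on partitions. -/
def relabel (g : Equiv.Perm α) : Setoid α ≃o Setoid α where
  toFun r := r.comap (g⁻¹ : Equiv.Perm α)
  invFun r := r.comap g
  left_inv r := by
    ext a b
    simp [Setoid.comap_rel]
  right_inv r := by
    ext a b
    simp [Setoid.comap_rel]
  map_rel_iff' := by
    intro r s
    refine ⟨fun h a b hab => ?_, fun h a b hab => h hab⟩
    have h1 : r (g⁻¹ (g a)) (g⁻¹ (g b)) := by simpa using hab
    simpa [Setoid.comap_rel] using
      (show s.comap (g⁻¹ : Equiv.Perm α) (g a) (g b) from h h1)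

variable {g : Equiv.Perm α} {r v w t y z : Setoid α}

@[simp]
theorem relabel_apply_apply {a b : α} : relabel g r (g a) (g b) ↔ r a b := by
  change r (g⁻¹ (g a)) (g⁻¹ (g b)) ↔ _
  simp

theorem relabel_eq {s : Setoid α} (h : ∀ a b, r a b ↔ s (g a) (g b)) : relabel g r = s := by
  ext a b
  obtain ⟨a, rfl⟩ := g.surjective a
  obtain ⟨b, rfl⟩ := g.surjective b
  exact (relabel_apply_apply (g := g)).trans (h a b)

@[simp]
theorem apply_mem_support_relabel {a : α} : g a ∈ (relabel g r).support ↔ a ∈ r.support := by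
  exact (g.exists_congr fun b => and_congr (not_congr g.apply_eq_iff_eq).symm
    relabel_apply_apply.symm).symm

@[simp]
theorem full_relabel : Full (relabel g r) ↔ Full r := by
  exact (g.forall_congr fun a => apply_mem_support_relabel.symm).symm

@[simp]
theorem thin_relabel : Thin (relabel g w) (relabel g r) ↔ Thin w r := by
  refine (g.forall_congr fun a => imp_congr apply_mem_support_relabel.symm <|
    g.forall_congr fun b => imp_congr apply_mem_support_relabel.symm <|
    g.forall_congr fun c => imp_congr apply_mem_support_relabel.symm ?_).symm
  rw [relabel_apply_apply, relabel_apply_apply, g.apply_eq_iff_eq, g.apply_eq_iff_eq,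
    g.apply_eq_iff_eq]

@[simp]
theorem closedIn_relabel : ClosedIn (relabel g z) (relabel g y) ↔ ClosedIn z y := by
  refine (g.forall_congr fun a => imp_congr apply_mem_support_relabel.symm <|
    g.forall_congr fun b => imp_congr apply_mem_support_relabel.symm <|
    imp_congr relabel_apply_apply.symm relabel_apply_apply.symm).symm

theorem relabel_restrictTo_support :
    relabel g (restrictTo y.support z) = restrictTo (relabel g y).support (relabel g z) :=
  relabel_eq fun a b => by
    simp only [restrictTo_apply, apply_mem_support_relabel, relabel_apply_apply,
      EmbeddingLike.apply_eq_iff_eq]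

theorem IsTransversal.relabel (h : IsTransversal v w t) :
    IsTransversal (relabel g v) (Setoid.relabel g w) (Setoid.relabel g t) where
  le := (Setoid.relabel g).monotone h.le
  thin := thin_relabel.2 h.thin
  meets := g.forall_congr_right.1 fun a ha => by
    obtain ⟨b, hb, hab⟩ := h.meets a (apply_mem_support_relabel.1 ha)
    exact ⟨g b, apply_mem_support_relabel.2 hb, relabel_apply_apply.2 hab⟩

theorem thin_top_relabel : Thin ⊤ (relabel g r) ↔ Thin ⊤ r := by
  have := thin_relabel (g := g) (w := ⊤) (r := r)
  rwa [map_top] at this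

/-- The number of pairs of equivalent points. -/
noncomputable def pairCount (r : Setoid α) : ℕ := {p : α × α | r p.1 p.2}.ncard

theorem pairCount_strictMono [Finite α] : StrictMono (pairCount : Setoid α → ℕ) := by
  intro r s h
  refine Set.ncard_lt_ncard ⟨fun p hp => h.le hp, fun hs => h.not_ge ?_⟩ (Set.toFinite _)
  intro a b hab
  exact hs (show (a, b) ∈ {p : α × α | s p.1 p.2} from hab)

theorem pairCount_relabel : pairCount (relabel g r) = pairCount r := by
  have : {p : α × α | relabel g r p.1 p.2} = Equiv.prodCongr g g '' {p : α × α | r p.1 p.2} := by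
    ext ⟨a, b⟩
    obtain ⟨a, rfl⟩ := g.surjective a
    obtain ⟨b, rfl⟩ := g.surjective b
    simp
  rw [pairCount, this, Set.ncard_image_of_injective _ (Equiv.injective _), pairCount]

theorem relabel_swap_eq [DecidableEq α] {a b : α} (h : r a b ∨ (a ∉ r.support ∧ b ∉ r.support)) :
    relabel (Equiv.swap a b) r = r := by
  have key : ∀ x y, r x y → r (Equiv.swap a b x) (Equiv.swap a b y) := by
    intro x y hxy
    rcases h with h | ⟨ha, hb⟩
    · have h1 : ∀ x, r x (Equiv.swap a b x) := by
        intro x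
        by_cases hxa : x = a
        · rw [hxa, Equiv.swap_apply_left]
          exact h
        by_cases hxb : x = b
        · rw [hxb, Equiv.swap_apply_right]
          exact r.symm' h
        rw [Equiv.swap_apply_of_ne_of_ne hxa hxb]
      exact r.trans' (r.symm' (h1 x)) (r.trans' hxy (h1 y))
    · by_cases hne : x = y
      · rw [hne]
      · have hx := mem_support_left hxy hne
        have hy := mem_support_right hxy hne
        rw [Equiv.swap_apply_of_ne_of_ne, Equiv.swap_apply_of_ne_of_ne]
        · exact hxy
        · rintro rfl
          exact ha hy
        · rintro rfl
          exact hb hy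
        · rintro rfl
          exact ha hx
        · rintro rfl
          exact hb hx
  refine relabel_eq fun x y => ⟨key x y, fun h => ?_⟩
  simpa using key _ _ h

/-- Exchanging two blocks with two elements leaves a partition fixed. -/
theorem relabel_swap_mul_swap_eq [DecidableEq α] {a b a' b' : α} (hab : a ≠ b) (hab' : a' ≠ b')
    (h : ∀ u, r a u ↔ u = a ∨ u = b) (h' : ∀ u, r a' u ↔ u = a' ∨ u = b')
    (hd : ¬ r a a') : relabel (Equiv.swap a a' * Equiv.swap b b') r = r := by
  have rab : r a b := (h b).2 (Or.inr rfl)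
  have rab' : r a' b' := (h' b').2 (Or.inr rfl)
  have haa' : a ≠ a' := fun e => hd (e ▸ r.refl' a)
  have hbb' : b ≠ b' := by
    rintro rfl
    exact hd (r.trans' rab (r.symm' rab'))
  have hab'' : a ≠ b' := by
    rintro rfl
    exact hd (r.symm' rab')
  have hba' : b ≠ a' := by
    rintro rfl
    exact hd rab
  set g := Equiv.swap a a' * Equiv.swap b b' with hg
  have ga : g a = a' := by
    rw [hg, Equiv.Perm.mul_apply, Equiv.swap_apply_of_ne_of_ne hab hab'', Equiv.swap_apply_left]
  have gb : g b = b' := by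
    rw [hg, Equiv.Perm.mul_apply, Equiv.swap_apply_left,
      Equiv.swap_apply_of_ne_of_ne hab''.symm hab'.symm]
  have ga' : g a' = a := by
    rw [hg, Equiv.Perm.mul_apply, Equiv.swap_apply_of_ne_of_ne hba'.symm hab',
      Equiv.swap_apply_right]
  have gb' : g b' = b := by
    rw [hg, Equiv.Perm.mul_apply, Equiv.swap_apply_right,
      Equiv.swap_apply_of_ne_of_ne hab.symm hba']
  have go : ∀ u, u ≠ a → u ≠ b → u ≠ a' → u ≠ b' → g u = u := fun u h1 h2 h3 h4 => by
    rw [hg, Equiv.Perm.mul_apply, Equiv.swap_apply_of_ne_of_ne h2 h4,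
      Equiv.swap_apply_of_ne_of_ne h1 h3]
  have gg : ∀ u, g (g u) = u := by
    intro u
    by_cases h1 : u = a
    · rw [h1, ga, ga']
    by_cases h2 : u = b
    · rw [h2, gb, gb']
    by_cases h3 : u = a'
    · rw [h3, ga', ga]
    by_cases h4 : u = b'
    · rw [h4, gb', gb]
    rw [go u h1 h2 h3 h4, go u h1 h2 h3 h4]
  have key : ∀ u v, r u v → r (g u) (g v) := by
    intro u v huv
    by_cases hu : r a u
    · have hv := r.trans' hu huv
      rcases (h u).1 hu with rfl | rfl <;> rcases (h v).1 hv with rfl | rfl <;>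
        simp only [ga, gb, r.refl', rab', r.symm' rab']
    by_cases hu' : r a' u
    · have hv := r.trans' hu' huv
      rcases (h' u).1 hu' with rfl | rfl <;> rcases (h' v).1 hv with rfl | rfl <;>
        simp only [ga', gb', r.refl', rab, r.symm' rab]
    have hv : ¬ r a v := fun hv => hu (r.trans' hv (r.symm' huv))
    have hv' : ¬ r a' v := fun hv => hu' (r.trans' hv (r.symm' huv))
    rw [h, not_or] at hu hv
    rw [h', not_or] at hu' hv'
    rwa [go u hu.1 hu.2 hu'.1 hu'.2, go v hv.1 hv.2 hv'.1 hv'.2]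
  refine relabel_eq fun u v => ⟨key u v, fun huv => ?_⟩
  have := key _ _ huv
  rwa [gg, gg] at this

theorem relabel_mul (g h : Equiv.Perm α) : relabel (g * h) r = relabel g (relabel h r) :=
  relabel_eq fun a b => by
    rw [Equiv.Perm.mul_apply, Equiv.Perm.mul_apply]
    exact ((relabel_apply_apply (g := g)).trans (relabel_apply_apply (g := h))).symm

end Setoid

/-! ### Chains of partitions -/

namespace ProperPartition

open Setoid Trisp

variable {n : ℕ}

open Classical in
/-- The smallest partition with the property `q` in a chain with the coarsest partition added. -/
noncomputable def least (q : Setoid (Fin n) → Prop) (c : Finset (ProperPartition n)) :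
    Setoid (Fin n) :=
  (c.filter fun x => q x.1).inf fun x => x.1

variable {q : Setoid (Fin n) → Prop} {c ρ : Finset (ProperPartition n)}
  {t t' x y : ProperPartition n}

theorem least_le (hx : x ∈ c) (hq : q x.1) : least q c ≤ x.1 := by
  classical
  exact Finset.inf_le (f := fun x : ProperPartition n => x.1) (Finset.mem_filter.2 ⟨hx, hq⟩)

/-- In a chain the infimum is attained; the infimum of the empty set is `⊤`. -/
theorem least_cases (hc : IsChain (· ≤ ·) (c : Set (ProperPartition n)))
    (q : Setoid (Fin n) → Prop) : least q c = ⊤ ∨ ∃ x ∈ c, q x.1 ∧ least q c = x.1 := by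
  classical
  by_cases h : (c.filter fun x => q x.1).Nonempty
  · obtain ⟨x, hx⟩ := (c.filter fun x => q x.1).exists_minimal h
    have hx' := Finset.mem_filter.1 hx.1
    refine Or.inr ⟨x, hx'.1, hx'.2, (least_le hx'.1 hx'.2).antisymm (Finset.le_inf fun y hy => ?_)⟩
    rcases hc.total hx'.1 (Finset.mem_filter.1 hy).1 with h3 | h3
    · exact h3
    · exact hx.2 hy h3
  · left
    rw [Finset.not_nonempty_iff_eq_empty] at h
    rw [least, h, Finset.inf_empty]

theorem least_mono (h : c ⊆ ρ) : least q ρ ≤ least q c :=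
  Finset.inf_mono (by classical exact Finset.filter_subset_filter _ h)

theorem least_insert [DecidableEq (ProperPartition n)] (h : q t.1 → least q c ≤ t.1) :
    least q (insert t c) = least q c := by
  classical
  by_cases hq : q t.1
  · have := h hq
    rw [least, Finset.filter_insert, if_pos hq, Finset.inf_insert]
    exact inf_eq_right.2 this
  · rw [least, Finset.filter_insert, if_neg hq, least]

theorem least_congr (h : ∀ x ∈ ρ, q x.1 → x ∈ c) (hcρ : c ⊆ ρ) : least q c = least q ρ := by
  classical
  refine le_antisymm (Finset.le_inf fun x hx => ?_) (least_mono hcρ)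
  rw [Finset.mem_filter] at hx
  exact least_le (h x hx.1 hx.2) hx.2

theorem coe_partitionAction (g : Equiv.Perm (Fin n)) (x : ProperPartition n) :
    (partitionAction n g x).1 = relabel g x.1 := rfl

theorem least_translate (g : Equiv.Perm (Fin n)) {q' : Setoid (Fin n) → Prop}
    (hq : ∀ r, q' (relabel g r) ↔ q r) :
    least q' (Trisp.translate (partitionAction n) g c) = relabel g (least q c) := by
  classical
  have h : (Trisp.translate (partitionAction n) g c).filter (fun x => q' x.1) =
      Trisp.translate (partitionAction n) g (c.filter fun x => q x.1) := by
    rw [Trisp.translate, Trisp.translate, Finset.filter_map]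
    exact congrArg _ (Finset.filter_congr fun p hp => hq p.1)
  rw [least, h, Trisp.translate, Finset.inf_map, least, map_finset_inf]
  rfl

/-- The smallest partition without singleton blocks. -/
noncomputable def leastFull (c : Finset (ProperPartition n)) : Setoid (Fin n) := least Full c

/-- The smallest partition without singleton blocks that has a block with more than two elements. -/
noncomputable def leastBig (c : Finset (ProperPartition n)) : Setoid (Fin n) :=
  least (fun r => Full r ∧ ¬ Thin r r) c

/-- The smallest partition that is not thin with respect to `leastBig c`. -/
noncomputable def pivot (c : Finset (ProperPartition n)) : Setoid (Fin n) :=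
  least (fun r => ¬ Thin (leastBig c) r) c

/-- A full partition has every point in its support, so thinness for `w` would pass to `w` itself.
-/
theorem not_thin_of_full {w r : Setoid (Fin n)} (hw : ¬ Thin w w) (hr : Full r) : ¬ Thin w r :=
  fun h => hw (h.mono fun a _ => hr a)

theorem full_top_of_three_le (hn : 3 ≤ n) : Full (⊤ : Setoid (Fin n)) := by
  have : Nontrivial (Fin n) := Fin.nontrivial_iff_two_le.2 (by omega)
  exact full_top

/-- Three distinct points in the single block are the obstruction; this lets `⊤` serve as default
value of `leastBig`. -/
theorem not_thin_top (hn : 3 ≤ n) : ¬ Thin (⊤ : Setoid (Fin n)) ⊤ := by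
  intro h
  have hf := full_top_of_three_le hn
  have := h ⟨0, by omega⟩ (hf _) ⟨1, by omega⟩ (hf _) ⟨2, by omega⟩ (hf _) trivial trivial
  simp at this

theorem leastFull_full (hn : 3 ≤ n) (hc : IsChain (· ≤ ·) (c : Set (ProperPartition n))) :
    Full (leastFull c) := by
  rcases least_cases hc Full with h | ⟨x, _, h2, h⟩ <;> rw [leastFull, h]
  · exact full_top_of_three_le hn
  · exact h2

theorem leastBig_spec (hn : 3 ≤ n) (hc : IsChain (· ≤ ·) (c : Set (ProperPartition n))) :
    Full (leastBig c) ∧ ¬ Thin (leastBig c) (leastBig c) := by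
  rcases least_cases hc fun r => Full r ∧ ¬ Thin r r with h | ⟨x, _, h2, h⟩ <;> rw [leastBig, h]
  · exact ⟨full_top_of_three_le hn, not_thin_top hn⟩
  · exact h2

theorem not_thin_leastBig (hn : 3 ≤ n) (hc : IsChain (· ≤ ·) (c : Set (ProperPartition n)))
    {r : Setoid (Fin n)} (hr : Full r) : ¬ Thin (leastBig c) r :=
  not_thin_of_full (leastBig_spec hn hc).2 hr

theorem leastFull_le_leastBig (hc : IsChain (· ≤ ·) (c : Set (ProperPartition n))) :
    leastFull c ≤ leastBig c := by
  rcases least_cases hc fun r => Full r ∧ ¬ Thin r r with h | ⟨x, h1, h2, h⟩ <;> rw [leastBig, h]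
  · exact le_top
  · exact least_le h1 h2.1

/-- Full elements are never thin for `leastBig c`, so they all compete in the definition of `pivot
c`. -/
theorem pivot_le_leastFull (hn : 3 ≤ n) (hc : IsChain (· ≤ ·) (c : Set (ProperPartition n))) :
    pivot c ≤ leastFull c := by
  rcases least_cases hc Full with h | ⟨x, h1, h2, h⟩ <;> rw [leastFull, h]
  · exact le_top
  · exact least_le h1 (not_thin_leastBig hn hc h2)

theorem pivot_le_leastBig (hn : 3 ≤ n) (hc : IsChain (· ≤ ·) (c : Set (ProperPartition n))) :
    pivot c ≤ leastBig c :=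
  (pivot_le_leastFull hn hc).trans (leastFull_le_leastBig hc)

theorem not_thin_pivot (hn : 3 ≤ n) (hc : IsChain (· ≤ ·) (c : Set (ProperPartition n))) :
    ¬ Thin (leastBig c) (pivot c) := by
  rcases least_cases hc fun r => ¬ Thin (leastBig c) r with h | ⟨x, h1, h2, h⟩ <;> rw [pivot, h]
  · exact not_thin_leastBig hn hc (full_top_of_three_le hn)
  · exact h2

/-- Partitions coarser than `leastFull c` are trivially closed in it. -/
theorem le_leastFull (hc : IsChain (· ≤ ·) (c : Set (ProperPartition n))) (hx : x ∈ c)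
    (h : ¬ ClosedIn (leastFull c) x.1) : x.1 ≤ leastFull c := by
  rcases least_cases hc Full with hz | ⟨z, h1, h2, hz⟩ <;> rw [leastFull, hz] at h ⊢
  · exact le_top
  · exact (hc.total hx h1).resolve_right fun hzx => h (closedIn_of_le hzx)

theorem not_full_of_not_closedIn (hx : x ∈ c) (h : ¬ ClosedIn (leastFull c) x.1) : ¬ Full x.1 :=
  fun hf => h (closedIn_of_le (least_le hx hf))

theorem le_pivot (hc : IsChain (· ≤ ·) (c : Set (ProperPartition n))) (hx : x ∈ c)
    (h : Thin (leastBig c) x.1) : x.1 ≤ pivot c := by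
  rcases least_cases hc fun r => ¬ Thin (leastBig c) r with hv | ⟨v, h1, h2, hv⟩ <;> rw [pivot, hv]
  · exact le_top
  · exact (hc.total hx h1).resolve_right fun hvx => h2 (h.mono (support_mono hvx))

/-! ### Adding and removing elements -/

/-- The partition `t` is obtained from the largest element of `c` that is not closed by joining the
nontrivial blocks inside each block of `leastFull c`. -/
def IsClosure (c : Finset (ProperPartition n)) (t : ProperPartition n) : Prop :=
  ∃ y ∈ c, ¬ ClosedIn (leastFull c) y.1 ∧
    (∀ y' ∈ c, ¬ ClosedIn (leastFull c) y'.1 → y' ≤ y) ∧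
    t.1 = restrictTo y.1.support (leastFull c)

/-- All elements of `c` are closed, and `t` picks one pair in each block of `leastBig c` in which
`pivot c` is not trivial, extending all thin elements of `c`. -/
structure IsSelection (c : Finset (ProperPartition n)) (t : ProperPartition n) : Prop where
  closed : ∀ y ∈ c, ClosedIn (leastFull c) y.1
  transversal : IsTransversal (pivot c) (leastBig c) t.1
  thin_le : ∀ x ∈ c, Thin (leastBig c) x.1 → x ≤ t

/-- The properties that both kinds of added elements have in common. -/
structure Neutral (c : Finset (ProperPartition n)) (t : ProperPartition n) : Prop where
  not_full : ¬ Full t.1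
  closed : ClosedIn (leastFull c) t.1
  below : ¬ Thin (leastBig c) t.1 → ∃ y ∈ c, y ≠ t ∧ y ≤ t ∧ ¬ Thin (leastBig c) y.1

/-- The closure has the same support as `y`, hence is full or thin exactly when `y` is. -/
theorem IsClosure.neutral (hc : IsChain (· ≤ ·) (c : Set (ProperPartition n)))
    (h : IsClosure c t) : Neutral c t := by
  obtain ⟨y, hy, hyz, -, ht⟩ := h
  have hle := le_leastFull hc hy hyz
  have hsupp : t.1.support = y.1.support := by rw [ht, support_restrictTo hle]
  have hcl : ClosedIn (leastFull c) t.1 := ht ▸ closedIn_restrictTo hle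
  refine ⟨fun hf => not_full_of_not_closedIn hy hyz fun a => hsupp ▸ hf a, hcl, fun hthin =>
    ⟨y, hy, ?_, ?_, fun hthin' => hthin (hthin'.mono hsupp.le)⟩⟩
  · rintro rfl
    exact hyz hcl
  · change y.1 ≤ t.1
    rw [ht]
    exact le_restrictTo hle

/-- A selection is thin for `leastBig c`, which rules out fullness; closedness in `leastBig c`
passes to the finer `leastFull c`. -/
theorem IsSelection.neutral (hn : 3 ≤ n) (hc : IsChain (· ≤ ·) (c : Set (ProperPartition n)))
    (h : IsSelection c t) : Neutral c t := by
  refine ⟨fun hf => not_thin_leastBig hn hc hf h.transversal.thin, ?_, fun hthin =>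
    absurd h.transversal.thin hthin⟩
  intro a ha b hb hab
  exact h.transversal.closedIn (pivot_le_leastBig hn hc) a ha b hb (leastFull_le_leastBig hc hab)

section Insert

variable [DecidableEq (ProperPartition n)]

theorem leastFull_insert (h : ¬ Full t.1) : leastFull (insert t c) = leastFull c :=
  least_insert fun h' => absurd h' h

theorem leastBig_insert (h : ¬ Full t.1) : leastBig (insert t c) = leastBig c :=
  least_insert fun h' => absurd h'.1 h

theorem pivot_insert (h : ¬ Full t.1) (h' : ¬ Thin (leastBig c) t.1 → pivot c ≤ t.1) :
    pivot (insert t c) = pivot c := by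
  rw [pivot, leastBig_insert h]
  exact least_insert h'

theorem Neutral.pivot_insert (h : Neutral c t) : pivot (insert t c) = pivot c := by
  refine ProperPartition.pivot_insert h.not_full fun ht => ?_
  obtain ⟨y, hy, -, hyt, hthin⟩ := h.below ht
  exact (least_le hy hthin).trans hyt

theorem Neutral.erase (h : Neutral c t) (ht : t ∈ c) : Neutral (c.erase t) t := by
  have h1 := leastFull_insert (c := c.erase t) h.not_full
  have h2 := leastBig_insert (c := c.erase t) h.not_full
  rw [Finset.insert_erase ht] at h1 h2
  refine ⟨h.not_full, h1 ▸ h.closed, ?_⟩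
  rw [← h2]
  intro hthin
  obtain ⟨y, hy, hne, hyt⟩ := h.below hthin
  exact ⟨y, Finset.mem_erase.2 ⟨hne, hy⟩, hne, hyt⟩

end Insert

open Classical in
/-- The order in which the chains are removed. -/
noncomputable def chainHeight (c : Finset (ProperPartition n)) : ℕ ×ₗ (ℕ ×ₗ ℕ) :=
  -- The number of full elements comes first: while it is unchanged in a larger chain, `leastFull`
  -- and `leastBig` are fixed and the later coordinates are comparable. Enlarging the chain can then
  -- only refine the pivot, hence the subtraction.
  toLex ((c.filter fun x => Full x.1).card,
    toLex (topRank (fun x => pairCount x.1) (fun x => ¬ ClosedIn (leastFull c) x.1) c,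
      pairCount (⊤ : Setoid (Fin n)) - pairCount (pivot c)))

theorem Neutral.chainHeight_insert [DecidableEq (ProperPartition n)] (h : Neutral c t) :
    chainHeight (insert t c) = chainHeight c := by
  have h1 := topRank_insert (r := fun x : ProperPartition n => pairCount x.1)
    (q := fun x => ¬ ClosedIn (leastFull c) x.1) (c := c) (not_not.2 h.closed)
  rw [chainHeight, leastFull_insert h.not_full, h.pivot_insert, h1, chainHeight, Finset.filter_insert, if_neg h.not_full]

theorem Neutral.chainHeight_erase [DecidableEq (ProperPartition n)] (h : Neutral c t)
    (ht : t ∈ c) : chainHeight (c.erase t) = chainHeight c := by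
  rw [← (h.erase ht).chainHeight_insert, Finset.insert_erase ht]

theorem pairCount_coe_strictMono : StrictMono fun x : ProperPartition n => pairCount x.1 :=
  fun _ _ h => pairCount_strictMono h

theorem full_mem_of_card_eq (h : c ⊆ ρ) [DecidablePred fun x : ProperPartition n => Full x.1]
    (hcard : (ρ.filter fun x => Full x.1).card ≤ (c.filter fun x => Full x.1).card) :
    ∀ x ∈ ρ, Full x.1 → x ∈ c := by
  intro x hx hf
  have := Finset.eq_of_subset_of_card_le (Finset.filter_subset_filter _ h) hcard
  exact (Finset.mem_filter.1 (this ▸ Finset.mem_filter.2 ⟨hx, hf⟩ : x ∈ c.filter _)).1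

theorem leastFull_congr (h : c ⊆ ρ) (hf : ∀ x ∈ ρ, Full x.1 → x ∈ c) :
    leastFull c = leastFull ρ := least_congr hf h

theorem leastBig_congr (h : c ⊆ ρ) (hf : ∀ x ∈ ρ, Full x.1 → x ∈ c) :
    leastBig c = leastBig ρ := least_congr (fun x hx hq => hf x hx hq.1) h

theorem pivot_mono (h : c ⊆ ρ) (hf : ∀ x ∈ ρ, Full x.1 → x ∈ c) : pivot ρ ≤ pivot c := by
  rw [pivot, pivot, leastBig_congr h hf]
  exact least_mono h

theorem chainHeight_mono (h : c ⊆ ρ) : chainHeight c ≤ chainHeight ρ := by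
  classical
  rw [chainHeight, chainHeight, Prod.Lex.toLex_le_toLex]
  rcases (Finset.card_le_card (Finset.filter_subset_filter (fun x : ProperPartition n => Full x.1)
    h)).lt_or_eq with hlt | heq
  · exact Or.inl (by convert hlt)
  have hf := full_mem_of_card_eq h heq.ge
  refine Or.inr ⟨by convert heq, ?_⟩
  change toLex _ ≤ toLex _
  rw [leastFull_congr h hf, Prod.Lex.toLex_le_toLex]
  rcases (topRank_mono (r := fun x : ProperPartition n => pairCount x.1)
    (q := fun x => ¬ ClosedIn (leastFull ρ) x.1) h).lt_or_eq with hlt | heq'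
  · exact Or.inl hlt
  · exact Or.inr ⟨heq', Nat.sub_le_sub_left (pairCount_strictMono.monotone (pivot_mono h hf)) _⟩

/-- What it means for a subchain to have the same height. -/
theorem eq_of_chainHeight_eq (h : c ⊆ ρ) (heq : chainHeight c = chainHeight ρ) :
    leastFull c = leastFull ρ ∧ leastBig c = leastBig ρ ∧ pivot c = pivot ρ ∧
      topRank (fun x => pairCount x.1) (fun x => ¬ ClosedIn (leastFull ρ) x.1) c =
        topRank (fun x => pairCount x.1) (fun x => ¬ ClosedIn (leastFull ρ) x.1) ρ := by
  classical
  obtain ⟨h1, h2⟩ := Prod.mk.inj (toLex.injective heq)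
  obtain ⟨h3, h4⟩ := Prod.mk.inj (toLex.injective h2)
  have hf := full_mem_of_card_eq h h1.ge
  have hz := leastFull_congr h hf
  refine ⟨hz, leastBig_congr h hf, ?_, hz ▸ h3⟩
  have h5 := pivot_mono h hf
  rcases h5.lt_or_eq with h6 | h6
  · have h7 := pairCount_strictMono h6
    -- This bound keeps the truncated subtraction in the height from hiding a strict inequality.
    have h8 := pairCount_strictMono.monotone (le_top : pivot c ≤ ⊤)
    omega
  · exact h6.symm

end ProperPartition

namespace Trisp

theorem translate_eq_self {P G : Type} [PartialOrder P] [Group G] {A : G →* (P ≃o P)} {g : G}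
    {c : Finset P} (h : ∀ x ∈ c, A g x = x) : translate A g c = c := by
  refine Finset.eq_of_subset_of_card_le ?_ (Finset.card_map _).ge
  rw [Finset.subset_iff, forall_mem_translate]
  exact fun x hx => (h x hx).symm ▸ hx

end Trisp

namespace ProperPartition

open Setoid Trisp

variable {n : ℕ} {c ρ : Finset (ProperPartition n)} {t t' x y : ProperPartition n}

/-! ### Equivariance -/

section Equivariance

variable (g : Equiv.Perm (Fin n))

theorem leastFull_translate :
    leastFull (Trisp.translate (partitionAction n) g c) = relabel g (leastFull c) :=
  least_translate g fun _ => full_relabel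

theorem leastBig_translate :
    leastBig (Trisp.translate (partitionAction n) g c) = relabel g (leastBig c) :=
  least_translate g fun _ => and_congr full_relabel (not_congr thin_relabel)

theorem pivot_translate :
    pivot (Trisp.translate (partitionAction n) g c) = relabel g (pivot c) :=
  least_translate g fun _ => by rw [leastBig_translate, thin_relabel]

theorem chainHeight_translate :
    chainHeight (Trisp.translate (partitionAction n) g c) = chainHeight c := by
  classical
  have h1 : (Trisp.translate (partitionAction n) g c).filter (fun x => Full x.1) =
      Trisp.translate (partitionAction n) g (c.filter fun x => Full x.1) := by
    rw [Trisp.translate, Trisp.translate, Finset.filter_map]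
    exact congrArg _ (Finset.filter_congr fun p hp => full_relabel)
  have h2 : topRank (fun x : ProperPartition n => pairCount x.1)
      (fun x => ¬ ClosedIn (relabel g (leastFull c)) x.1)
      (Trisp.translate (partitionAction n) g c) =
      topRank (fun x => pairCount x.1) (fun x => ¬ ClosedIn (leastFull c) x.1) c :=
    topRank_translate (A := partitionAction n) g c (fun _ => pairCount_relabel)
      fun p _ => not_congr (closedIn_relabel (y := p.1))
  have h3 : ((Trisp.translate (partitionAction n) g c).filter fun x => Full x.1).card =
      (c.filter fun x => Full x.1).card := by
    rw [h1]
    exact Finset.card_map _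
  rw [chainHeight, leastFull_translate, h2, pivot_translate, pairCount_relabel, chainHeight]
  refine congrArg (fun m => toLex (m, _)) ?_
  convert h3

variable {g}

theorem IsClosure.translate (h : IsClosure c t) :
    IsClosure (Trisp.translate (partitionAction n) g c) (partitionAction n g t) := by
  obtain ⟨y, hy, hyz, hmax, ht⟩ := h
  refine ⟨partitionAction n g y, mem_translate.2 hy, ?_, ?_, ?_⟩
  · rw [leastFull_translate, coe_partitionAction, closedIn_relabel]
    exact hyz
  · rw [forall_mem_translate]
    intro y' hy' h
    rw [leastFull_translate, coe_partitionAction, closedIn_relabel] at h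
    exact (partitionAction n g).monotone (hmax y' hy' h)
  · rw [coe_partitionAction, coe_partitionAction, ht, relabel_restrictTo_support,
      leastFull_translate]

theorem IsSelection.translate (h : IsSelection c t) :
    IsSelection (Trisp.translate (partitionAction n) g c) (partitionAction n g t) where
  closed := by
    rw [forall_mem_translate, leastFull_translate]
    exact fun y hy => closedIn_relabel.2 (h.closed y hy)
  transversal := by
    rw [pivot_translate, leastBig_translate]
    exact h.transversal.relabel
  thin_le := by
    rw [forall_mem_translate, leastBig_translate]
    exact fun x hx hthin => (partitionAction n g).monotone (h.thin_le x hx (thin_relabel.1 hthin))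

end Equivariance

/-! ### Selections are unique up to the stabilizer of the chain -/

theorem IsSelection.eq_of_support_subset (hn : 3 ≤ n)
    (hc : IsChain (· ≤ ·) (c : Set (ProperPartition n))) (h : IsSelection c t)
    (h' : IsSelection c t') (hle : t.1.support ⊆ t'.1.support) : t = t' :=
  Subtype.ext (h.transversal.eq_of_le h'.transversal (pivot_le_leastBig hn hc) hle)

/-- If the smallest full partition is big, then the nontrivial points of two selections can be
exchanged. -/
theorem IsSelection.exists_closer_of_not_thin (hn : 3 ≤ n)
    (hc : IsChain (· ≤ ·) (c : Set (ProperPartition n))) (h : IsSelection c t)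
    (h' : IsSelection c t') (hz : ¬ Thin (leastFull c) (leastFull c)) {a b' c' : Fin n}
    (ha : a ∈ t.1.support) (ha' : a ∉ t'.1.support) (hab' : leastBig c a b') (hbc' : t'.1 b' c')
    (hne' : b' ≠ c') :
    ∃ g : Equiv.Perm (Fin n), (∀ x ∈ c, partitionAction n g x = x) ∧
      ((partitionAction n g t).1.support \ t'.1.support).ncard <
        (t.1.support \ t'.1.support).ncard := by
  -- Here the least full element is itself big, so the two coincide.
  have hwz : leastBig c ≤ leastFull c := by
    rcases least_cases hc Full with hz' | ⟨z, h1, h2, hz'⟩ <;> rw [leastFull, hz']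
    · exact le_top
    · rw [leastFull, hz'] at hz
      exact least_le h1 ⟨h2, hz⟩
  have hcl : ClosedIn (leastFull c) (pivot c) := by
    rcases least_cases hc fun r => ¬ Thin (leastBig c) r with hv | ⟨v, h1, h2, hv⟩ <;>
      rw [pivot, hv]
    · exact closedIn_of_le le_top
    · exact h.closed v h1
  have hb' := mem_support_left hbc' hne'
  have hc' := mem_support_right hbc' hne'
  have hac' : leastBig c a c' := (leastBig c).trans' hab'
    (pivot_le_leastBig hn hc (h'.transversal.le hbc'))
  -- Otherwise `a`, `b'`, `c'` would be three nontrivial points of `t` in one block of `leastBig c`.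
  obtain ⟨a', ha't', ha't, haa'⟩ : ∃ a' ∈ t'.1.support, a' ∉ t.1.support ∧ leastBig c a a' := by
    by_contra hcon
    push Not at hcon
    have hbt : b' ∈ t.1.support := by
      by_contra hb
      exact hcon b' hb' hb hab'
    have hct : c' ∈ t.1.support := by
      by_contra hb
      exact hcon c' hc' hb hac'
    rcases h.transversal.thin a ha b' hbt c' hct hab' hac' with e | e | e
    · exact ha' (e ▸ hb')
    · exact ha' (e ▸ hc')
    · exact hne' e
  have hvaa' : pivot c a a' := hcl a (support_mono h.transversal.le ha) a'
    (support_mono h'.transversal.le ha't') (hwz haa')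
  refine ⟨Equiv.swap a a', fun x hx => Subtype.ext ?_, ?_⟩
  · rw [coe_partitionAction]
    refine relabel_swap_eq ?_
    -- Thin elements lie below both selections, so `a` and `a'` are singletons in them; all others
    -- lie above the pivot, which joins `a` and `a'`.
    by_cases hthin : Thin (leastBig c) x.1
    · exact Or.inr ⟨fun hm => ha' (support_mono (h'.thin_le x hx hthin) hm),
        fun hm => ha't (support_mono (h.thin_le x hx hthin) hm)⟩
    · exact Or.inl ((least_le hx hthin : pivot c ≤ x.1) hvaa')
  · rw [coe_partitionAction]
    refine Set.ncard_lt_ncard ⟨?_, fun hs => ?_⟩ (Set.toFinite _)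
    · rintro u ⟨hu, hut'⟩
      obtain ⟨u, rfl⟩ := (Equiv.swap a a').surjective u
      rw [apply_mem_support_relabel] at hu
      have h1 : u ≠ a := by
        rintro rfl
        rw [Equiv.swap_apply_left] at hut'
        exact hut' ha't'
      have h2 : u ≠ a' := by
        rintro rfl
        exact ha't hu
      rw [Equiv.swap_apply_of_ne_of_ne h1 h2] at hut' ⊢
      exact ⟨hu, hut'⟩
    · refine ha't ((apply_mem_support_relabel (g := Equiv.swap a a')).1 ?_)
      rw [Equiv.swap_apply_right]
      exact (hs ⟨ha, ha'⟩).1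

/-- If the smallest full partition consists of pairs, then these pairs can be exchanged. -/
theorem IsSelection.exists_closer_of_thin (hn : 3 ≤ n)
    (hc : IsChain (· ≤ ·) (c : Set (ProperPartition n))) (h : IsSelection c t)
    (h' : IsSelection c t') (hz : Thin (leastFull c) (leastFull c)) {a b b' c' : Fin n}
    (hab : t.1 a b) (hne : a ≠ b) (ha' : a ∉ t'.1.support) (hab' : leastBig c a b')
    (hbc' : t'.1 b' c') (hne' : b' ≠ c') :
    ∃ g : Equiv.Perm (Fin n), (∀ x ∈ c, partitionAction n g x = x) ∧
      ((partitionAction n g t).1.support \ t'.1.support).ncard <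
        (t.1.support \ t'.1.support).ncard := by
  have hvz := pivot_le_leastFull hn hc
  have hzw : leastFull c ≤ leastBig c := leastFull_le_leastBig hc
  have hzf := leastFull_full hn hc
  -- Being full and thin for itself, `leastFull c` has only blocks of exactly two points.
  have hpair : ∀ {p q : Fin n}, leastFull c p q → p ≠ q →
      ∀ u, leastFull c p u → u = p ∨ u = q := by
    intro p q hpq hne u hu
    rcases hz p (hzf p) q (hzf q) u (hzf u) hpq hu with e | e | e
    · exact absurd e hne
    · exact Or.inl e.symm
    · exact Or.inr e.symm
  have ha := mem_support_left hab hne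
  have hb := mem_support_right hab hne
  have hb' := mem_support_left hbc' hne'
  have hc' := mem_support_right hbc' hne'
  have zab := hvz (h.transversal.le hab)
  have zbc' := hvz (h'.transversal.le hbc')
  have wab := hzw zab
  have wac' : leastBig c a c' := (leastBig c).trans' hab' (hzw zbc')
  have wbc' : leastBig c b c' := (leastBig c).trans' ((leastBig c).symm' wab) wac'
  have hbt' : b ∉ t'.1.support := by
    rintro ⟨d, hdb, hbd⟩
    rcases hpair ((leastFull c).symm' zab) hne.symm d (hvz (h'.transversal.le hbd)) with e | e
    · exact hdb e
    · exact ha' (e ▸ mem_support_right hbd hdb.symm)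
  have hnot : ∀ u ∈ t'.1.support, leastBig c a u → u ∉ t.1.support := by
    intro u hu hau hut
    rcases h.transversal.thin a ha b hb u hut wab hau with e | e | e
    · exact hne e
    · exact ha' (e ▸ hu)
    · exact hbt' (e ▸ hu)
  have hb't := hnot b' hb' hab'
  have hc't := hnot c' hc' wac'
  have hzab' : ¬ leastFull c a b' := by
    intro hu
    rcases hpair zab hne b' hu with e | e
    · exact ha' (e ▸ hb')
    · exact hbt' (e ▸ hb')
  have hac'ne : a ≠ c' := by
    rintro rfl
    exact ha' hc'
  have hbb'ne : b ≠ b' := by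
    rintro rfl
    exact hbt' hb'
  have hbc'ne : b ≠ c' := by
    rintro rfl
    exact hbt' hc'
  have hab'ne : a ≠ b' := by
    rintro rfl
    exact ha' hb'
  -- The permutation exchanges the pair of `t` with the pair of `t'` in their common block of
  -- `leastBig c`.
  refine ⟨Equiv.swap a b' * Equiv.swap b c', fun x hx => Subtype.ext ?_, ?_⟩
  · rw [coe_partitionAction]
    by_cases hthin : Thin (leastBig c) x.1
    · have hxt := support_mono (h.thin_le x hx hthin)
      have hxt' := support_mono (h'.thin_le x hx hthin)
      rw [relabel_mul, relabel_swap_eq (Or.inr ⟨fun hm => hbt' (hxt' hm), fun hm => hc't (hxt hm)⟩),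
        relabel_swap_eq (Or.inr ⟨fun hm => ha' (hxt' hm), fun hm => hb't (hxt hm)⟩)]
    have hvx : pivot c ≤ x.1 := least_le hx hthin
    by_cases hwx : leastBig c ≤ x.1
    · rw [relabel_mul, relabel_swap_eq (Or.inl (hwx wbc')), relabel_swap_eq (Or.inl (hwx hab'))]
    -- A full element not above `leastBig c` also has only two-point blocks, hence refines
    -- `leastFull c`. So `x` lies between the pivot and `leastFull c`, and both pairs are blocks of
    -- `x`.
    have hxz : x.1 ≤ leastFull c := by
      by_cases hxf : Full x.1
      · have hzx : leastFull c ≤ x.1 := least_le hx hxf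
        have hxthin : Thin x.1 x.1 := by
          by_contra hcon
          exact hwx (least_le hx ⟨hxf, hcon⟩)
        intro u u' huu'
        by_cases huu : u = u'
        · exact huu ▸ (leastFull c).refl' u
        obtain ⟨d, hdu, hud⟩ := hzf u
        rcases hxthin u (hxf u) u' (hxf u') d (hxf d) huu' (hzx hud) with e | e | e
        · exact absurd e huu
        · exact absurd e.symm hdu
        · exact e ▸ hud
      · rcases least_cases hc Full with hz' | ⟨z, h1, h2, hz'⟩ <;> rw [leastFull, hz']
        · exact le_top
        · exact (hc.total hx h1).resolve_right fun hzx => hxf (h2.mono hzx)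
    refine relabel_swap_mul_swap_eq hne hne' (fun u => ⟨fun hu => hpair zab hne u (hxz hu), ?_⟩)
      (fun u => ⟨fun hu => hpair zbc' hne' u (hxz hu), ?_⟩) fun hu => hzab' (hxz hu)
    · rintro (rfl | rfl)
      · exact x.1.refl' _
      · exact hvx (h.transversal.le hab)
    · rintro (rfl | rfl)
      · exact x.1.refl' _
      · exact hvx (h'.transversal.le hbc')
  · have ga : (Equiv.swap a b' * Equiv.swap b c') a = b' := by
      rw [Equiv.Perm.mul_apply, Equiv.swap_apply_of_ne_of_ne hne hac'ne, Equiv.swap_apply_left]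
    have gb : (Equiv.swap a b' * Equiv.swap b c') b = c' := by
      rw [Equiv.Perm.mul_apply, Equiv.swap_apply_left,
        Equiv.swap_apply_of_ne_of_ne hac'ne.symm hne'.symm]
    have gb' : (Equiv.swap a b' * Equiv.swap b c') b' = a := by
      rw [Equiv.Perm.mul_apply, Equiv.swap_apply_of_ne_of_ne hbb'ne.symm hne',
        Equiv.swap_apply_right]
    rw [coe_partitionAction]
    refine Set.ncard_lt_ncard ⟨?_, fun hs => ?_⟩ (Set.toFinite _)
    · rintro u ⟨hu, hut'⟩
      obtain ⟨u, rfl⟩ := (Equiv.swap a b' * Equiv.swap b c').surjective u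
      rw [apply_mem_support_relabel] at hu
      have h1 : u ≠ a := by
        rintro rfl
        rw [ga] at hut'
        exact hut' hb'
      have h2 : u ≠ b := by
        rintro rfl
        rw [gb] at hut'
        exact hut' hc'
      have h3 : u ≠ b' := by
        rintro rfl
        exact hb't hu
      have h4 : u ≠ c' := by
        rintro rfl
        exact hc't hu
      rw [Equiv.Perm.mul_apply, Equiv.swap_apply_of_ne_of_ne h2 h4,
        Equiv.swap_apply_of_ne_of_ne h1 h3] at hut' ⊢
      exact ⟨hu, hut'⟩
    · refine hb't ((apply_mem_support_relabel (g := Equiv.swap a b' * Equiv.swap b c')).1 ?_)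
      rw [gb']
      exact (hs ⟨ha, ha'⟩).1

/-- Induction on the number of nontrivial points of `t` that are trivial in `t'`: an exchange fixing
the chain lowers it, and at zero the selections agree. -/
theorem IsSelection.exists_stabilizer (hn : 3 ≤ n)
    (hc : IsChain (· ≤ ·) (c : Set (ProperPartition n))) (h : IsSelection c t)
    (h' : IsSelection c t') : ∃ g : Equiv.Perm (Fin n),
      Trisp.translate (partitionAction n) g c = c ∧ partitionAction n g t = t' := by
  induction hm : (t.1.support \ t'.1.support).ncard using Nat.strong_induction_on generalizing t with
  | _ m ih =>
  by_cases hsub : t.1.support ⊆ t'.1.support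
  · refine ⟨1, translate_one c, ?_⟩
    rw [map_one]
    exact h.eq_of_support_subset hn hc h' hsub
  obtain ⟨a, ha, ha'⟩ := Set.not_subset.1 hsub
  obtain ⟨b', ⟨c', hne', hbc'⟩, hab'⟩ :=
    h'.transversal.meets a (support_mono h.transversal.le ha)
  obtain ⟨g, hg, hlt⟩ : ∃ g : Equiv.Perm (Fin n), (∀ x ∈ c, partitionAction n g x = x) ∧
      ((partitionAction n g t).1.support \ t'.1.support).ncard <
        (t.1.support \ t'.1.support).ncard := by
    by_cases hz : Thin (leastFull c) (leastFull c)
    · obtain ⟨b, hne, hab⟩ := ha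
      exact h.exists_closer_of_thin hn hc h' hz hab hne.symm ha' hab' hbc' hne'.symm
    · exact h.exists_closer_of_not_thin hn hc h' hz ha ha' hab' hbc' hne'.symm
  have hgc := translate_eq_self hg
  have hgt := h.translate (g := g)
  rw [hgc] at hgt
  obtain ⟨k, hk, hkt⟩ := ih _ (hm ▸ hlt) hgt rfl
  refine ⟨k * g, by rw [translate_mul, hgc, hk], ?_⟩
  rw [map_mul]
  exact hkt

end ProperPartition

namespace ProperPartition

open Setoid Trisp

variable {n : ℕ} {c ρ : Finset (ProperPartition n)} {t t' x y : ProperPartition n}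

/-! ### The matching on chains of partitions -/

/-- The largest thin element of the chain, or `⊥` if there is none, is extended to a transversal of
the pivot. -/
theorem exists_isSelection (hn : 3 ≤ n) (hc : IsChain (· ≤ ·) (c : Set (ProperPartition n)))
    (h : ∀ y ∈ c, ClosedIn (leastFull c) y.1) : ∃ t, IsSelection c t := by
  obtain ⟨q, hqv, hq, hle⟩ : ∃ q : Setoid (Fin n), q ≤ pivot c ∧ Thin (leastBig c) q ∧
      ∀ x ∈ c, Thin (leastBig c) x.1 → x.1 ≤ q := by
    by_cases hex : ∃ x ∈ c, Thin (leastBig c) x.1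
    · obtain ⟨q, hqc, hq, hmax⟩ := exists_maximum_of_isChain hc hex
      exact ⟨q.1, le_pivot hc hqc hq, hq, hmax⟩
    · exact ⟨⊥, bot_le, thin_bot _, fun x hx hthin => absurd ⟨x, hx, hthin⟩ hex⟩
  obtain ⟨t, ht, hqt⟩ := exists_isTransversal (pivot_le_leastBig hn hc) hqv hq
  have hne : t ≠ ⊥ := by
    have hv : (pivot c).support.Nonempty := by
      rw [support_nonempty_iff]
      intro hbot
      exact not_thin_pivot hn hc (hbot ▸ thin_bot _)
    obtain ⟨a, ha⟩ := hv
    obtain ⟨b, hb, -⟩ := ht.meets a ha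
    exact support_nonempty_iff.1 ⟨b, hb⟩
  have hne' : t ≠ ⊤ := by
    rintro rfl
    exact not_thin_leastBig hn hc (full_top_of_three_le hn) ht.thin
  exact ⟨⟨t, hne, hne'⟩, h, ht, fun x hx hthin => (hle x hx hthin).trans hqt⟩

theorem exists_isClosure (hn : 3 ≤ n) (hc : IsChain (· ≤ ·) (c : Set (ProperPartition n)))
    (h : ¬ ∀ y ∈ c, ClosedIn (leastFull c) y.1) : ∃ t, IsClosure c t := by
  push Not at h
  obtain ⟨y, hy, hyz, hmax⟩ := exists_maximum_of_isChain hc h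
  have hle := le_leastFull hc hy hyz
  have hsupp := support_restrictTo hle
  have hne : restrictTo y.1.support (leastFull c) ≠ ⊥ := by
    rw [← support_nonempty_iff, hsupp, support_nonempty_iff]
    exact y.2.1
  have hne' : restrictTo y.1.support (leastFull c) ≠ ⊤ := by
    intro htop
    refine not_full_of_not_closedIn hy hyz fun a => ?_
    rw [← hsupp, htop]
    exact full_top_of_three_le hn a
  exact ⟨⟨_, hne, hne'⟩, y, hy, hyz, hmax, rfl⟩

theorem not_isSelection_of_isClosure (h : IsClosure c t) : ¬ IsSelection c t' := by
  obtain ⟨y, hy, hyz, -⟩ := h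
  exact fun h' => hyz (h'.closed y hy)

theorem IsClosure.unique (h : IsClosure c t) (h' : IsClosure c t') : t = t' := by
  obtain ⟨y, hy, hyz, hmax, ht⟩ := h
  obtain ⟨y', hy', hyz', hmax', ht'⟩ := h'
  rw [(hmax' y hy hyz).antisymm (hmax y' hy' hyz')] at ht
  exact Subtype.ext (ht.trans ht'.symm)

theorem neutral_of_isClosure_or_isSelection (hn : 3 ≤ n)
    (hc : IsChain (· ≤ ·) (c : Set (ProperPartition n))) (h : IsClosure c t ∨ IsSelection c t) :
    Neutral c t :=
  h.elim (fun h => h.neutral hc) fun h => h.neutral hn hc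

/-- Equal height fixes `leastFull` and the top rank of non-closed elements, so the largest
non-closed element of `ρ` already lies in `c`. -/
theorem IsClosure.restrict (hcρ : c ⊆ ρ) (heq : chainHeight c = chainHeight ρ)
    (h : IsClosure ρ t) : IsClosure c t := by
  obtain ⟨y, hy, hyz, hmax, ht⟩ := h
  obtain ⟨h1, -, -, h4⟩ := eq_of_chainHeight_eq hcρ heq
  refine ⟨y, mem_of_topRank_eq pairCount_coe_strictMono hcρ hy hyz hmax h4, ?_, ?_, ?_⟩
  · rwa [h1]
  · intro y' hy' h'
    exact hmax y' (hcρ hy') (h1 ▸ h')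
  · rw [h1, ht]

theorem IsSelection.restrict (hcρ : c ⊆ ρ) (heq : chainHeight c = chainHeight ρ)
    (h : IsSelection ρ t) : IsSelection c t := by
  obtain ⟨h1, h2, h3, -⟩ := eq_of_chainHeight_eq hcρ heq
  refine ⟨?_, ?_, ?_⟩
  · rw [h1]
    exact fun y hy => h.closed y (hcρ hy)
  · rw [h2, h3]
    exact h.transversal
  · rw [h2]
    exact fun x hx => h.thin_le x (hcρ hx)

theorem IsClosure.insert [DecidableEq (ProperPartition n)] (hN : Neutral c t)
    (h : IsClosure c t) : IsClosure (insert t c) t := by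
  obtain ⟨y, hy, hyz, hmax, ht⟩ := h
  have h1 := leastFull_insert (c := c) hN.not_full
  refine ⟨y, Finset.mem_insert_of_mem hy, by rwa [h1], ?_, by rw [h1, ht]⟩
  intro y' hy' h'
  rw [h1] at h'
  rcases Finset.mem_insert.1 hy' with rfl | hy'
  · exact absurd hN.closed h'
  · exact hmax y' hy' h'

theorem IsSelection.insert [DecidableEq (ProperPartition n)] (hN : Neutral c t)
    (h : IsSelection c t) : IsSelection (insert t c) t := by
  have h1 := leastFull_insert (c := c) hN.not_full
  have h2 := leastBig_insert (c := c) hN.not_full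
  refine ⟨?_, ?_, ?_⟩
  · rw [h1]
    intro y hy
    rcases Finset.mem_insert.1 hy with rfl | hy
    · exact hN.closed
    · exact h.closed y hy
  · rw [h2, hN.pivot_insert]
    exact h.transversal
  · rw [h2]
    intro x hx hthin
    rcases Finset.mem_insert.1 hx with rfl | hx
    · exact le_rfl
    · exact h.thin_le x hx hthin

theorem IsClosure.comparable (hc : IsChain (· ≤ ·) (c : Set (ProperPartition n)))
    (h : IsClosure c t) (hx : x ∈ c) : x ≤ t ∨ t ≤ x := by
  obtain ⟨y, hy, hyz, hmax, ht⟩ := h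
  have hyt : y ≤ t := by
    change y.1 ≤ t.1
    rw [ht]
    exact le_restrictTo (le_leastFull hc hy hyz)
  by_cases hxz : ClosedIn (leastFull c) x.1
  · rcases hc.total hx hy with hxy | hyx
    · exact Or.inl (hxy.trans hyt)
    · right
      change t.1 ≤ x.1
      rw [ht]
      exact restrictTo_support_le hyx hxz
  · exact Or.inl ((hmax x hx hxz).trans hyt)

/-- Thin elements lie below `t` by choice; the others lie above the pivot and hence above `t`. -/
theorem IsSelection.comparable (h : IsSelection c t) (hx : x ∈ c) : x ≤ t ∨ t ≤ x := by
  by_cases hthin : Thin (leastBig c) x.1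
  · exact Or.inl (h.thin_le x hx hthin)
  · exact Or.inr (h.transversal.le.trans (least_le hx hthin))

/-- As `t` is thin for `leastBig c` but not for `⊤`, `leastBig c` is a genuine element of the chain;
it is full, while `t` is not. -/
theorem exists_not_thin_top_of_isSelection (hn : 3 ≤ n)
    (hc : IsChain (· ≤ ·) (c : Set (ProperPartition n))) (h : IsSelection c t)
    (ht : ¬ Thin ⊤ t.1) : ∃ y ∈ c, y ≠ t ∧ ¬ Thin ⊤ y.1 := by
  have hw := (leastBig_spec hn hc).2
  rcases least_cases hc fun r => Full r ∧ ¬ Thin r r with h1 | ⟨x, hx, hxq, h1⟩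
  · exact absurd h.transversal.thin (by rwa [leastBig, h1])
  · refine ⟨x, hx, ?_, fun hthin => hxq.2 (hthin.anti le_top)⟩
    rintro rfl
    exact (h.neutral hn hc).not_full hxq.1

/-- The matching on the chains of partitions other than the single atoms. -/
noncomputable def toggle [DecidableEq (ProperPartition n)] (hn : 3 ≤ n) :
    Toggle (partitionAction n) (fun c => ∃ x ∈ c, ¬ Thin ⊤ x.1) (ℕ ×ₗ (ℕ ×ₗ ℕ)) where
  height := chainHeight
  Tog c t := IsClosure c t ∨ IsSelection c t
  mem_upward := fun h ⟨y, hy, hy'⟩ => ⟨y, h hy, hy'⟩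
  nonempty := fun ⟨y, hy, _⟩ => ⟨y, hy⟩
  mono _ h := chainHeight_mono h
  exists_tog := by
    intro c hc _
    by_cases h : ∀ y ∈ c, ClosedIn (leastFull c) y.1
    · obtain ⟨t, ht⟩ := exists_isSelection hn hc h
      exact ⟨t, Or.inr ht⟩
    · obtain ⟨t, ht⟩ := exists_isClosure hn hc h
      exact ⟨t, Or.inl ht⟩
  isChain_insert hc h := isChain_insert_of_comparable hc fun _ hx =>
    h.elim (fun h => h.comparable hc hx) fun h => h.comparable hx
  tog_insert hc h _ :=
    have hN := neutral_of_isClosure_or_isSelection hn hc h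
    h.imp (fun h => h.insert hN) fun h => h.insert hN
  height_insert hc h _ := (neutral_of_isClosure_or_isSelection hn hc h).chainHeight_insert
  height_erase hc h ht := (neutral_of_isClosure_or_isSelection hn hc h).chainHeight_erase ht
  mem_erase := by
    rintro c t hc ⟨x, hx, hthin⟩ h _
    by_cases hxt : x = t
    · subst hxt
      obtain ⟨y, hy, hne, hy'⟩ : ∃ y ∈ c, y ≠ x ∧ ¬ Thin ⊤ y.1 := by
        rcases h with h | h
        · have hcl := (h.neutral hc).closed
          obtain ⟨y, hy, hyz, -, ht⟩ := h
          -- The element `y` whose closure is `t` has the same support, so it witnesses that the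
          -- remaining chain is still matched.
          refine ⟨y, hy, ?_, fun hy' => hthin (hy'.mono ?_)⟩
          · rintro rfl
            exact hyz hcl
          · rw [ht, support_restrictTo (le_leastFull hc hy hyz)]
        · exact exists_not_thin_top_of_isSelection hn hc h hthin
      exact ⟨y, Finset.mem_erase.2 ⟨hne, hy⟩, hy'⟩
    · exact ⟨x, Finset.mem_erase.2 ⟨hxt, hx⟩, hthin⟩
  restrict _ hcρ heq h := h.imp (fun h => h.restrict hcρ heq) fun h => h.restrict hcρ heq
  unique_of_mem := by
    rintro c t t' hc (h | h) (h' | h') ht'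
    · exact h.unique h'
    · exact absurd h' (not_isSelection_of_isClosure h)
    · exact absurd h (not_isSelection_of_isClosure h')
    -- A selection already in the chain is thin, hence below every other selection, and comparable
    -- transversals coincide.
    · exact (h'.eq_of_support_subset hn hc h
        (support_mono (h.thin_le t' ht' h'.transversal.thin))).symm
  unique_orbit := by
    rintro c t t' hc (h | h) (h' | h')
    · refine ⟨1, translate_one c, ?_⟩
      rw [map_one]
      exact h.unique h'
    · exact absurd h' (not_isSelection_of_isClosure h)
    · exact absurd h (not_isSelection_of_isClosure h')
    · exact h.exists_stabilizer hn hc h'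
  mem_translate := by
    intro c g h
    rw [exists_mem_translate]
    obtain ⟨x, hx, hthin⟩ := h
    exact ⟨x, hx, fun h' => hthin (thin_top_relabel.1 h')⟩
  height_translate g := chainHeight_translate g
  tog_translate _ h := h.imp IsClosure.translate IsSelection.translate

theorem isChain_empty :
    IsChain (· ≤ ·) ((∅ : Finset (ProperPartition n)) : Set (ProperPartition n)) := by
  simp [IsChain]

theorem isTransversal_top (hx : Thin ⊤ x.1) : IsTransversal ⊤ ⊤ x.1 := by
  obtain ⟨b, hb⟩ := support_nonempty_iff.2 x.2.1
  exact ⟨le_top, hx, fun _ _ => ⟨b, hb, trivial⟩⟩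

/-- For the empty chain, `pivot` and `leastBig` are both `⊤`, so the atoms are selections for it.
Conjugacy of selections thus yields transitivity on atoms. -/
theorem isSelection_empty (hx : Thin ⊤ x.1) : IsSelection ∅ x where
  closed := by simp
  transversal := by
    have h1 : pivot (∅ : Finset (ProperPartition n)) = ⊤ := by simp [pivot, least]
    have h2 : leastBig (∅ : Finset (ProperPartition n)) = ⊤ := by simp [leastBig, least]
    rw [h1, h2]
    exact isTransversal_top hx
  thin_le := by simp

theorem exists_thin_top (hn : 3 ≤ n) : ∃ x : ProperPartition n, Thin ⊤ x.1 := by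
  obtain ⟨t, ht⟩ := exists_isSelection (c := ∅) hn isChain_empty (by simp)
  have h1 := ht.transversal.thin
  have h2 : leastBig (∅ : Finset (ProperPartition n)) = ⊤ := by simp [leastBig, least]
  rw [h2] at h1
  exact ⟨t, h1⟩

end ProperPartition

/-! ### Collapsing the partition quotient onto the orbit of atoms. -/

/-- The subtrisp that consists of a single vertex. -/
def Trisp.vertexSubtrisp {T : Trisp} (v : T.Simplex 0) : T.Subtrisp where
  carrier := {⟨0, v⟩}
  face_mem := by
    intro m k f σ h
    obtain ⟨rfl, h⟩ := Sigma.mk.inj (Set.mem_singleton_iff.1 h)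
    obtain rfl := eq_of_heq h
    have hm : m = 0 := by
      have := Fintype.card_le_of_injective f f.injective
      simp only [Fintype.card_fin] at this
      omega
    subst hm
    have hf : f = RelEmbedding.refl _ := RelEmbedding.ext fun i => by
      apply Fin.ext
      omega
    rw [hf, T.face_refl]
    rfl

open ProperPartition Setoid Trisp in
theorem partitionQuotient_collapsible (n : ℕ) (hn : 3 ≤ n) :
    (partitionQuotient n).Collapsible := by
  classical
  obtain ⟨a, ha⟩ := exists_thin_top hn
  obtain ⟨α, hα⟩ := exists_chainSet_eq (P := ProperPartition n) (c := {a}) (k := 0)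
    (by simp [IsChain]) (by simp)
  refine ⟨(orbitCell (partitionAction n) α).2, vertexSubtrisp _, rfl, ?_⟩
  refine (toggle hn).collapsesOnto pairCount_coe_strictMono (fun _ _ => pairCount_relabel) _ ?_
  intro k σ
  change orbitCell (partitionAction n) σ = orbitCell (partitionAction n) α ↔ _
  rw [eq_comm, orbitCell_eq_iff, hα]
  push Not
  constructor
  · rintro ⟨g, hg⟩
    rw [← hg, forall_mem_translate]
    intro x hx
    rw [Finset.mem_singleton.1 hx]
    exact thin_top_relabel.2 ha
  · intro h
    obtain ⟨x, hx⟩ := chainSet_nonempty σ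
    -- All elements of an unmatched chain are atoms, and comparable atoms are equal.
    have hσ : chainSet σ = {x} := by
      refine Finset.eq_singleton_iff_unique_mem.2 ⟨hx, fun y hy => ?_⟩
      rcases (isChain_chainSet σ).total hx hy with hxy | hyx
      · exact Subtype.ext ((isTransversal_top (h x hx)).eq_of_le (isTransversal_top (h y hy)) le_rfl
          (support_mono hxy)).symm
      · exact Subtype.ext ((isTransversal_top (h y hy)).eq_of_le (isTransversal_top (h x hx)) le_rfl
          (support_mono hyx))
    obtain ⟨g, -, hg⟩ :=
      (isSelection_empty ha).exists_stabilizer hn isChain_empty (isSelection_empty (h x hx))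
    refine ⟨g, ?_⟩
    rw [hσ, ← hg]
    exact Finset.map_singleton _ _

theorem corollary6p1 (n : ℕ) (hn : 3 ≤ n) :
    (bdDGQuotient n).Collapsible ∧
    (∀ k : ℕ, Function.Injective
      ((partitionQuotientMap n).toFun : (partitionQuotient n).Simplex k → _)) ∧
    (bdDGQuotient n).CollapsesOnto (partitionQuotientMap n).range ∧
    (partitionQuotient n).Collapsible := by
  have : NeZero n := ⟨by omega⟩
  have h := bdDGQuotient_collapsesOnto_range n
  have h' := partitionQuotient_collapsible n hn
  exact ⟨h'.of_injective (partitionQuotientMap n) (partitionQuotientMap_injective n) h,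
    partitionQuotientMap_injective n, h, h'⟩
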